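/- Let $0<b_0\le\infty$ and let $f,g$ be smooth real functions on $(0,b_0^2)$. Write points as $(t,s)$ with $t$ in the place of $b^2$, let $\varphi_1,\varphi_2$ denote the partial derivatives of $\varphi(t,s)$ in $t$ and in $s$, and consider the equation $$\varphi_{22}-2(\varphi_1-s\varphi_{12})=\{f(t)+g(t)s^2\}\{\varphi-s\varphi_2+(t-s^2)\varphi_{22}\}\qquad(*)$$ on open subsets of $\Omega=\{(t,s): s^2<t<b_0^2\}$. Let $P=\int (f+gt)\,dt$ and $Q=\int g e^{P}\,dt$ be any antiderivatives on $(0,b_0^2)$ and $$\eta(t,s)=\frac{t-s^2}{e^{P(t)}-(t-s^2)Q(t)}.$$ The general solution of $(*)$ is $$\varphi=s\left(h(t)-\int\frac{\Phi(\eta(t,s))}{s^2\sqrt{t-s^2}}\,ds\right),\qquad(**)$$ with $h,\Phi$ arbitrary smooth functions, in the following sense. Let $V\subseteq\Omega$ be open such that $s\neq0$ and the denominator of $\eta$ does not vanish on $V$. (1) If $\Phi$ is smooth on $\eta(V)$, $h$ is smooth on the projection of $V$ to the $t$-axis, and the indefinite integral in $(**)$ is any smooth function on $V$ with the indicated $s$-derivative,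 then $\varphi$ is a smooth solution of $(*)$ on $V$. (2) If the level sets of $\eta$ in $V$ and the sections $\{s:(t,s)\in V\}$ are connected (or empty), then for every smooth solution $\varphi$ of $(*)$ on $V$ there is a smooth function $\Phi$ on $\eta(V)$ such that the integral in $(**)$ exists as a smooth function on $V$, and for each choice of it there is a smooth $h$ with $(**)$ on all of $V$. (3) Let $U\subseteq\Omega$ be open and $\varphi$ smooth on $U$. Then $\varphi$ solves $(*)$ on $U$ if and only if every point of $U$ with $s\ne0$ has an open neighbourhood $V\subseteq U$ as above on which, for some $P,Q,h,\Phi$ and some choice of the integral, $\varphi$ is given by $(**)$. (4) Let $\varphi$ be smooth and positive on $\{|s|\le b<b_0\}$, where $t=b^2$, and near each point of $\Omega$ with $s\neq0$ be given by $(**)$ for some $P,Q,h,\Phi$ (as in (3), with $U=\Omega$). Let $M$ be a smooth manifold of dimension $n\ge2$ with a Riemannian metric $\alpha=\sqrt{a_{ij}y^iy^j}$ and a smooth $1$-form $\beta=b_iy^i$ such that $b=\|\beta\|_\alpha<b_0$ everywhere and $b_{i|j}=c\,a_{ij}$, where $c=c(x)\neq0$ is a scalar function and $b_{i|j}$ is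 the covariant derivative of $\beta$ with respect to $\alpha$. If $F=\alpha\,\varphi(b^2,\beta/\alpha)$ is a Finsler metric on $M$, then it is a Douglas metric: with the geodesic coefficients $G^i$ of $F$, $$D^i_{jkl}=\frac{\partial^3}{\partial y^j\partial y^k\partial y^l}\left(G^i-\frac1{n+1}\frac{\partial G^m}{\partial y^m}y^i\right)=0 .$$ -/

import Mathlib

open Set Bundle
open scoped ContDiff Manifold

noncomputable section

namespace GenAB

/-! ### Functions `φ(t, s)`, with `t` in the place of `b²` -/

/-- The values `t = b²` with `0 < b < b₀` (here `b₀` may be `+∞`). -/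
def baseInterval (b₀ : EReal) : Set ℝ :=
  {t | 0 < t ∧ ((√t : ℝ) : EReal) < b₀}

/-- The pairs `(b², s)` with `|s| ≤ b < b₀`. -/
def closedDomain (b₀ : EReal) : Set (ℝ × ℝ) :=
  {p | p.2 ^ 2 ≤ p.1 ∧ ((√p.1 : ℝ) : EReal) < b₀}

/-- The pairs `(b², s)` with `|s| < b < b₀`. -/
def openDomain (b₀ : EReal) : Set (ℝ × ℝ) :=
  {p | p.2 ^ 2 < p.1 ∧ ((√p.1 : ℝ) : EReal) < b₀}

/-- Derivative with respect to the first variable `t = b²`. -/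
def D1 (φ : ℝ → ℝ → ℝ) (t s : ℝ) : ℝ := deriv (fun t' => φ t' s) t

/-- Derivative with respect to the second variable `s`. -/
def D2 (φ : ℝ → ℝ → ℝ) (t s : ℝ) : ℝ := deriv (fun s' => φ t s') s

/-- The equation
`φ₂₂ - 2 (φ₁ - s φ₁₂) = (f + g s²) (φ - s φ₂ + (b² - s²) φ₂₂)` at `(b², s) = (t, s)`. -/
def DouglasPDE (f g : ℝ → ℝ) (φ : ℝ → ℝ → ℝ) (t s : ℝ) : Prop :=
  D2 (D2 φ) t s - 2 * (D1 φ t s - s * D2 (D1 φ) t s)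
    = (f t + g t * s ^ 2) * (φ t s - s * D2 φ t s + (t - s ^ 2) * D2 (D2 φ) t s)

/-- `P` is an antiderivative `∫ (f + g b²) db²` and `Q` an antiderivative
`∫ g e^{∫ (f + g b²) db²} db²`, where `0 < b < b₀`. -/
def IsAntiderivPair (b₀ : EReal) (f g P Q : ℝ → ℝ) : Prop :=
  ∀ t ∈ baseInterval b₀,
    HasDerivAt P (f t + g t * t) t ∧ HasDerivAt Q (g t * Real.exp (P t)) t

/-- The denominator of `η`. -/
def etaDen (P Q : ℝ → ℝ) (p : ℝ × ℝ) : ℝ :=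
  Real.exp (P p.1) - (p.1 - p.2 ^ 2) * Q p.1

/-- The function `η(b², s)`. -/
def eta (P Q : ℝ → ℝ) (p : ℝ × ℝ) : ℝ := (p.1 - p.2 ^ 2) / etaDen P Q p

/-- An open set of pairs `(b², s)` with `|s| < b < b₀` on which every term of the solution formula
makes sense: `s ≠ 0` and the denominator of `η` does not vanish. -/
structure IsRegion (b₀ : EReal) (P Q : ℝ → ℝ) (V : Set (ℝ × ℝ)) : Prop where
  isOpen : IsOpen V
  subset : V ⊆ openDomain b₀
  ne_zero : ∀ p ∈ V, p.2 ≠ 0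
  den_ne_zero : ∀ p ∈ V, etaDen P Q p ≠ 0

/-- `A` is, on `V`, a smooth indefinite integral `∫ Φ(η(b², s)) / (s² √(b² - s²)) ds`. -/
def IsIntegral (P Q Φ : ℝ → ℝ) (A : ℝ → ℝ → ℝ) (V : Set (ℝ × ℝ)) : Prop :=
  ContDiffOn ℝ ∞ (Function.uncurry A) V ∧
  ∀ p ∈ V, HasDerivAt (fun s => A p.1 s)
    (Φ (eta P Q p) / (p.2 ^ 2 * √(p.1 - p.2 ^ 2))) p.2

/-- On `V`, `φ = s (h(b²) - ∫ Φ(η(b², s)) / (s² √(b² - s²)) ds)`, the indefinite integral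
being `A`. -/
def SolutionFormula (h : ℝ → ℝ) (A φ : ℝ → ℝ → ℝ) (V : Set (ℝ × ℝ)) : Prop :=
  ∀ p ∈ V, φ p.1 p.2 = p.2 * (h p.1 - A p.1 p.2)

/-- Near each point of `U` with `s ≠ 0` the function `φ` is given by the solution formula, for some
choice of the indefinite integrals, of `h` and of `Φ`. -/
def LocallyOfSolutionForm (b₀ : EReal) (f g : ℝ → ℝ) (φ : ℝ → ℝ → ℝ) (U : Set (ℝ × ℝ)) : Prop :=
  ∀ p ∈ U, p.2 ≠ 0 → ∃ (P Q : ℝ → ℝ) (V : Set (ℝ × ℝ)),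
    IsAntiderivPair b₀ f g P Q ∧ IsRegion b₀ P Q V ∧ p ∈ V ∧ V ⊆ U ∧
    ∃ (Φ h : ℝ → ℝ) (A : ℝ → ℝ → ℝ),
      ContDiffOn ℝ ∞ Φ (eta P Q '' V) ∧ ContDiffOn ℝ ∞ h (Prod.fst '' V) ∧
      IsIntegral P Q Φ A V ∧ SolutionFormula h A φ V

/-! ### Finsler geometry in local coordinates -/

/-- Coordinate space. -/
abbrev Coord (n : ℕ) : Type := EuclideanSpace ℝ (Fin n)

/-- The `i`-th partial derivative. -/
def pd {n : ℕ} (i : Fin n) (u : Coord n → ℝ) (x : Coord n) : ℝ :=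
  fderiv ℝ u x (EuclideanSpace.single i 1)

/-- The fundamental tensor `g_{ij}(x, y) = ½ [F²]_{y^i y^j}`. -/
def fundamentalTensor {n : ℕ} (F : Coord n → Coord n → ℝ) (x y : Coord n) :
    Matrix (Fin n) (Fin n) ℝ :=
  Matrix.of fun i j => (1 / 2 : ℝ) * pd i (fun y' => pd j (fun y'' => F x y'' ^ 2) y') y

/-- The geodesic coefficients `G^i = ¼ g^{il} ([F²]_{x^k y^l} y^k - [F²]_{x^l})`. -/
def sprayCoeff {n : ℕ} (F : Coord n → Coord n → ℝ) (i : Fin n) (x y : Coord n) : ℝ :=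
  (1 / 4 : ℝ) * ∑ l, (fundamentalTensor F x y)⁻¹ i l *
    ((∑ k, pd l (fun y' => pd k (fun x' => F x' y' ^ 2) x) y * y k)
      - pd l (fun x' => F x' y ^ 2) x)

/-- The Douglas tensor
`D^i_{jkl} = ∂³/∂y^j∂y^k∂y^l (G^i - (n+1)⁻¹ (∂G^m/∂y^m) y^i)`. -/
def douglasTensor {n : ℕ} (F : Coord n → Coord n → ℝ) (i j k l : Fin n) (x y : Coord n) : ℝ :=
  pd j (pd k (pd l (fun y' => sprayCoeff F i x y'
    - (1 / ((n : ℝ) + 1)) * (∑ m, pd m (fun y'' => sprayCoeff F m x y'') y') * y' i))) y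

/-- The Christoffel symbols `Γ^k_{ij}` of the metric `a_{ij}`. -/
def christoffel {n : ℕ} (a : Coord n → Matrix (Fin n) (Fin n) ℝ) (k i j : Fin n)
    (x : Coord n) : ℝ :=
  (1 / 2 : ℝ) * ∑ l, (a x)⁻¹ k l *
    (pd i (fun x' => a x' l j) x + pd j (fun x' => a x' l i) x - pd l (fun x' => a x' i j) x)

/-- The covariant derivative `b_{i|j} = ∂_j b_i - Γ^k_{ij} b_k`. -/
def covDeriv {n : ℕ} (a : Coord n → Matrix (Fin n) (Fin n) ℝ) (b : Fin n → Coord n → ℝ)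
    (i j : Fin n) (x : Coord n) : ℝ :=
  pd j (b i) x - ∑ k, christoffel a k i j x * b k x

/-! ### The same notions on a manifold -/

section Manifold

variable {n : ℕ} {M : Type*} [TopologicalSpace M] [ChartedSpace (Coord n) M]

/-- The tangent vector of `M` at `e.symm x` whose components in the chart `e` are `y`. -/
def chartVector (e : OpenPartialHomeomorph M (Coord n)) (x y : Coord n) :
    TangentSpace 𝓘(ℝ, Coord n) (e.symm x) :=
  mfderiv 𝓘(ℝ, Coord n) 𝓘(ℝ, Coord n) e.symm x y

/-- The expression `F(x, y)` in the chart `e` of a function on the tangent bundle. -/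
def inChart (F : ∀ x : M, TangentSpace 𝓘(ℝ, Coord n) x → ℝ)
    (e : OpenPartialHomeomorph M (Coord n)) (x y : Coord n) : ℝ :=
  F (e.symm x) (chartVector e x y)

variable [IsManifold 𝓘(ℝ, Coord n) ∞ M]

/-- A Finsler metric: smooth on the slit tangent bundle, positive, positively homogeneous of
degree one and strongly convex. -/
structure IsFinsler (F : ∀ x : M, TangentSpace 𝓘(ℝ, Coord n) x → ℝ) : Prop where
  smooth : ContMDiffOn 𝓘(ℝ, Coord n).tangent 𝓘(ℝ, ℝ) ∞
    (fun v : TangentBundle 𝓘(ℝ, Coord n) M => F v.proj v.snd) {v | v.snd ≠ 0}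
  pos : ∀ (x : M) (v : TangentSpace 𝓘(ℝ, Coord n) x), v ≠ 0 → 0 < F x v
  homogeneous : ∀ (x : M) (v : TangentSpace 𝓘(ℝ, Coord n) x) (r : ℝ), 0 ≤ r →
    F x (r • v) = r * F x v
  convex : ∀ e ∈ IsManifold.maximalAtlas 𝓘(ℝ, Coord n) ∞ M, ∀ x ∈ e.target, ∀ y : Coord n,
    y ≠ 0 → (fundamentalTensor (inChart F e) x y).PosDef

/-- A Finsler metric whose Douglas tensor vanishes. -/
def IsDouglas (F : ∀ x : M, TangentSpace 𝓘(ℝ, Coord n) x → ℝ) : Prop :=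
  IsFinsler F ∧
  ∀ e ∈ IsManifold.maximalAtlas 𝓘(ℝ, Coord n) ∞ M, ∀ x ∈ e.target, ∀ y : Coord n, y ≠ 0 →
    ∀ i j k l, douglasTensor (inChart F e) i j k l x y = 0

variable (n M) in
/-- Smooth Riemannian metrics on `M`. -/
abbrev Metric : Type _ :=
  ContMDiffRiemannianMetric 𝓘(ℝ, Coord n) ∞ (Coord n)
    (fun x : M => TangentSpace 𝓘(ℝ, Coord n) x)

/-- Smoothness of a `1`-form, as a section of the cotangent bundle. -/
def SmoothOneForm (β : ∀ x : M, TangentSpace 𝓘(ℝ, Coord n) x →L[ℝ] ℝ) : Prop :=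
  ContMDiff 𝓘(ℝ, Coord n) (𝓘(ℝ, Coord n).prod 𝓘(ℝ, Coord n →L[ℝ] ℝ)) ∞
    (fun x : M => TotalSpace.mk' (Coord n →L[ℝ] ℝ)
      (E := fun x : M => TangentSpace 𝓘(ℝ, Coord n) x →L[ℝ] Bundle.Trivial M ℝ x) x (β x))

/-- `α(x, v)`, the length of a tangent vector. -/
def alpha (a : Metric n M) (x : M) (v : TangentSpace 𝓘(ℝ, Coord n) x) : ℝ :=
  √(a.inner x v v)

/-- `b(x) = ‖β_x‖_α`, the norm of `β` with respect to `α`. -/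
def betaNorm (a : Metric n M) (β : ∀ x : M, TangentSpace 𝓘(ℝ, Coord n) x →L[ℝ] ℝ) (x : M) : ℝ :=
  sSup {r | ∃ v : TangentSpace 𝓘(ℝ, Coord n) x, alpha a x v ≤ 1 ∧ r = |β x v|}

/-- The components `a_{ij}` of the metric in the chart `e`. -/
def metricInChart (a : Metric n M) (e : OpenPartialHomeomorph M (Coord n)) (x : Coord n) :
    Matrix (Fin n) (Fin n) ℝ :=
  Matrix.of fun i j => a.inner (e.symm x) (chartVector e x (EuclideanSpace.single i 1))
    (chartVector e x (EuclideanSpace.single j 1))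

/-- The components `b_i` of a `1`-form in the chart `e`. -/
def formInChart (β : ∀ x : M, TangentSpace 𝓘(ℝ, Coord n) x →L[ℝ] ℝ)
    (e : OpenPartialHomeomorph M (Coord n)) (i : Fin n) (x : Coord n) : ℝ :=
  β (e.symm x) (chartVector e x (EuclideanSpace.single i 1))

/-- `b_{i|j} = c a_{ij}` in all charts. -/
def IsClosedConformal (a : Metric n M) (β : ∀ x : M, TangentSpace 𝓘(ℝ, Coord n) x →L[ℝ] ℝ)
    (c : M → ℝ) : Prop :=
  ∀ e ∈ IsManifold.maximalAtlas 𝓘(ℝ, Coord n) ∞ M, ∀ x ∈ e.target, ∀ i j,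
    covDeriv (metricInChart a e) (formInChart β e) i j x
      = c (e.symm x) * metricInChart a e x i j

/-- The function `F = α φ(b², β/α)` on the tangent bundle. -/
def generalAB (a : Metric n M) (β : ∀ x : M, TangentSpace 𝓘(ℝ, Coord n) x →L[ℝ] ℝ)
    (φ : ℝ → ℝ → ℝ) (x : M) (v : TangentSpace 𝓘(ℝ, Coord n) x) : ℝ :=
  alpha a x v * φ (betaNorm a β x ^ 2) (β x v / alpha a x v)

end Manifold

end GenAB

end

namespace GenAB

open Filter Topology Function

/-! ### Domains -/

/-! Put `w = √(t - s²) (φ - s φ₂)`. Although the equation has second order in `φ`, where `s ≠ 0` it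
is equivalent to a linear homogeneous first-order equation for `w`: `w_s (1 - (f + g s²)(t - s²)) +
2 s w_t = 0` (`transported_transportFn_iff`). The function `η` solves the same equation and `η_s ≠
0` when `s ≠ 0`. So `η` is a first integral of the characteristics, and the solutions `w` are
locally the functions `Φ(η)` (`exists_local_factor`). Since `(φ / s)_s = -(φ - s φ₂) / s²`, knowing
`w = Φ(η)` amounts to `-φ / s` being an indefinite integral of `Φ(η) / (s² √(t - s²))`, which is the
solution formula with `h` as constant of integration. Connected level sets of `η` glue the local `Φ`
into one, and connected sections make `h` depend on `t` alone. At `s = 0` the equation follows by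
continuity.

For the Douglas property, work in a chart. From `b_{i|j} = c a_{ij}` one gets `d(b²) = 2cβ`, and the
`x`-derivatives of `F` consist of a Christoffel part and a multiple of `c`. The candidate `G^i = ½
Γ^i_{jk} y^j y^k + ½ c (f α² + g β²) b^i + P y^i` then satisfies the linear system that determines
the geodesic coefficients: the component along `F_{y^l}` fixes `P`, and the component along `b_l - s
y_l / α` vanishes exactly because of the equation for `φ` (`spray_identity`). The first two terms
are quadratic in `y`, and the Douglas tensor does not see `P y^i` when `P` is homogeneous of degree
one (`douglas_eq_zero_of_projective`).

This covers only the directions with `|β| < bα`, where the equation is available. Such directions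
are dense when `β ≠ 0` and `n ≥ 2`, and the points with `β ≠ 0` are dense because `c ≠ 0`. The
Douglas tensor is continuous off the zero section, so it vanishes everywhere
(`douglasTensor_eq_zero`). -/

theorem isOpen_baseInterval (b₀ : EReal) : IsOpen (baseInterval b₀) :=
  (isOpen_lt continuous_const continuous_id).inter
    (isOpen_lt (continuous_coe_real_ereal.comp Real.continuous_sqrt) continuous_const)

theorem isOpen_openDomain (b₀ : EReal) : IsOpen (openDomain b₀) :=
  (isOpen_lt (continuous_snd.pow 2) continuous_fst).inter
    (isOpen_lt (continuous_coe_real_ereal.comp (Real.continuous_sqrt.comp continuous_fst))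
      continuous_const)

theorem ordConnected_baseInterval (b₀ : EReal) : OrdConnected (baseInterval b₀) := by
  refine ⟨fun x hx y hy z hz => ⟨hx.1.trans_le hz.1, lt_of_le_of_lt ?_ hy.2⟩⟩
  exact_mod_cast Real.sqrt_le_sqrt hz.2

theorem fst_mem_baseInterval {b₀ : EReal} {p : ℝ × ℝ} (hp : p ∈ openDomain b₀) :
    p.1 ∈ baseInterval b₀ :=
  ⟨(sq_nonneg _).trans_lt hp.1, hp.2⟩

theorem openDomain_subset_closedDomain (b₀ : EReal) : openDomain b₀ ⊆ closedDomain b₀ :=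
  fun _ hp => ⟨hp.1.le, hp.2⟩

/-! ### Partial derivatives in the plane -/

section Partial

variable {φ : ℝ → ℝ → ℝ} {V : Set (ℝ × ℝ)} {p : ℝ × ℝ}

theorem hasDerivAt_fst {w : ℝ × ℝ → ℝ} (h : DifferentiableAt ℝ w p) :
    HasDerivAt (fun t => w (t, p.2)) (fderiv ℝ w p (1, 0)) p.1 := by
  have h1 : HasDerivAt (fun t : ℝ => (t, p.2)) ((1 : ℝ), (0 : ℝ)) p.1 :=
    (hasDerivAt_id p.1).prodMk (hasDerivAt_const p.1 p.2)
  exact HasFDerivAt.comp_hasDerivAt p.1 (f := fun t : ℝ => (t, p.2)) h.hasFDerivAt h1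

theorem hasDerivAt_snd {w : ℝ × ℝ → ℝ} (h : DifferentiableAt ℝ w p) :
    HasDerivAt (fun s => w (p.1, s)) (fderiv ℝ w p (0, 1)) p.2 := by
  have h1 : HasDerivAt (fun s : ℝ => (p.1, s)) ((0 : ℝ), (1 : ℝ)) p.2 :=
    (hasDerivAt_const p.2 p.1).prodMk (hasDerivAt_id p.2)
  exact HasFDerivAt.comp_hasDerivAt p.2 (f := fun s : ℝ => (p.1, s)) h.hasFDerivAt h1

theorem D1_eq_fderiv (h : DifferentiableAt ℝ (uncurry φ) p) :
    D1 φ p.1 p.2 = fderiv ℝ (uncurry φ) p (1, 0) :=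
  (hasDerivAt_fst h).deriv

theorem D2_eq_fderiv (h : DifferentiableAt ℝ (uncurry φ) p) :
    D2 φ p.1 p.2 = fderiv ℝ (uncurry φ) p (0, 1) :=
  (hasDerivAt_snd h).deriv

theorem hasDerivAt_D1 (h : DifferentiableAt ℝ (uncurry φ) p) :
    HasDerivAt (fun t => φ t p.2) (D1 φ p.1 p.2) p.1 :=
  (hasDerivAt_fst h).differentiableAt.hasDerivAt

theorem hasDerivAt_D2 (h : DifferentiableAt ℝ (uncurry φ) p) :
    HasDerivAt (fun s => φ p.1 s) (D2 φ p.1 p.2) p.2 :=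
  (hasDerivAt_snd h).differentiableAt.hasDerivAt

theorem differentiableAt_of_smooth {w : ℝ × ℝ → ℝ} (hV : IsOpen V) (h : ContDiffOn ℝ ∞ w V)
    (hp : p ∈ V) : DifferentiableAt ℝ w p :=
  (h.contDiffAt (hV.mem_nhds hp)).differentiableAt (by simp)

theorem contDiffOn_D1 (hV : IsOpen V) (h : ContDiffOn ℝ ∞ (uncurry φ) V) :
    ContDiffOn ℝ ∞ (uncurry (D1 φ)) V :=
  ((h.fderiv_of_isOpen hV le_rfl).clm_apply contDiffOn_const).congr
    fun _ hp => D1_eq_fderiv (differentiableAt_of_smooth hV h hp)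

theorem contDiffOn_D2 (hV : IsOpen V) (h : ContDiffOn ℝ ∞ (uncurry φ) V) :
    ContDiffOn ℝ ∞ (uncurry (D2 φ)) V :=
  ((h.fderiv_of_isOpen hV le_rfl).clm_apply contDiffOn_const).congr
    fun _ hp => D2_eq_fderiv (differentiableAt_of_smooth hV h hp)

theorem D1_D2_comm (hV : IsOpen V) (h : ContDiffOn ℝ ∞ (uncurry φ) V) (hp : p ∈ V) :
    D1 (D2 φ) p.1 p.2 = D2 (D1 φ) p.1 p.2 := by
  have hd := h.fderiv_of_isOpen hV (m := ∞) le_rfl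
  have hdp : DifferentiableAt ℝ (fderiv ℝ (uncurry φ)) p :=
    (hd.contDiffAt (hV.mem_nhds hp)).differentiableAt (by simp)
  have e1 : uncurry (D1 φ) =ᶠ[𝓝 p] fun q => fderiv ℝ (uncurry φ) q (1, 0) := by
    filter_upwards [hV.mem_nhds hp] with q hq
    exact D1_eq_fderiv (differentiableAt_of_smooth hV h hq)
  have e2 : uncurry (D2 φ) =ᶠ[𝓝 p] fun q => fderiv ℝ (uncurry φ) q (0, 1) := by
    filter_upwards [hV.mem_nhds hp] with q hq
    exact D2_eq_fderiv (differentiableAt_of_smooth hV h hq)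
  rw [D1_eq_fderiv (differentiableAt_of_smooth hV (contDiffOn_D2 hV h) hp),
    D2_eq_fderiv (differentiableAt_of_smooth hV (contDiffOn_D1 hV h) hp), e1.fderiv_eq,
    e2.fderiv_eq, fderiv_clm_apply hdp (by fun_prop), fderiv_clm_apply hdp (by fun_prop)]
  have := (h.contDiffAt (hV.mem_nhds hp)).isSymmSndFDerivAt
    (by simpa using (ENat.LEInfty.out : (2 : ℕ∞ω) ≤ ∞))
  simpa using this (1, 0) (0, 1)

end Partial

/-! ### The antiderivatives -/

section Antiderivatives

variable {b₀ : EReal} {f g P Q : ℝ → ℝ}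

theorem contDiffOn_of_hasDerivAt {u u' : ℝ → ℝ} {I : Set ℝ} (hI : IsOpen I)
    (h : ∀ t ∈ I, HasDerivAt u (u' t) t) (hu : ContDiffOn ℝ ∞ u' I) : ContDiffOn ℝ ∞ u I :=
  (contDiffOn_infty_iff_deriv_of_isOpen hI).2
    ⟨fun t ht => (h t ht).differentiableAt.differentiableWithinAt,
      hu.congr fun t ht => (h t ht).deriv⟩

theorem IsAntiderivPair.contDiffOn (hPQ : IsAntiderivPair b₀ f g P Q)
    (hf : ContDiffOn ℝ ∞ f (baseInterval b₀)) (hg : ContDiffOn ℝ ∞ g (baseInterval b₀)) :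
    ContDiffOn ℝ ∞ P (baseInterval b₀) ∧ ContDiffOn ℝ ∞ Q (baseInterval b₀) := by
  have hP := contDiffOn_of_hasDerivAt (isOpen_baseInterval b₀) (fun t ht => (hPQ t ht).1)
    (hf.add (hg.mul contDiffOn_id))
  exact ⟨hP, contDiffOn_of_hasDerivAt (isOpen_baseInterval b₀) (fun t ht => (hPQ t ht).2)
    (hg.mul (Real.contDiff_exp.comp_contDiffOn hP))⟩

theorem exists_antiderivative {I : Set ℝ} (hI : IsOpen I) (hc : OrdConnected I) {u : ℝ → ℝ}
    (hu : ContinuousOn u I) {t₀ : ℝ} (ht₀ : t₀ ∈ I) :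
    ∃ U : ℝ → ℝ, U t₀ = 0 ∧ ∀ t ∈ I, HasDerivAt U (u t) t := by
  refine ⟨fun t => ∫ x in t₀..t, u x, by simp, fun t ht => ?_⟩
  refine intervalIntegral.integral_hasDerivAt_right ?_ ?_ (hu.continuousAt (hI.mem_nhds ht))
  · exact (hu.mono (hc.uIcc_subset ht₀ ht)).intervalIntegrable
  · exact ContinuousOn.stronglyMeasurableAtFilter hI hu t ht

/-- The normalisation `Q t₀ = 0` makes the denominator of `η` equal to `e^P` at every point over
`t₀`, so any point with `s ≠ 0` lies in a region for a suitable pair. -/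
theorem exists_isAntiderivPair (hf : ContDiffOn ℝ ∞ f (baseInterval b₀))
    (hg : ContDiffOn ℝ ∞ g (baseInterval b₀)) {t₀ : ℝ} (ht₀ : t₀ ∈ baseInterval b₀) :
    ∃ P Q : ℝ → ℝ, IsAntiderivPair b₀ f g P Q ∧ Q t₀ = 0 := by
  obtain ⟨P, -, hP⟩ := exists_antiderivative (isOpen_baseInterval b₀)
    (ordConnected_baseInterval b₀) (u := fun t => f t + g t * t)
    (hf.continuousOn.add (hg.continuousOn.mul continuousOn_id)) ht₀
  have hPc : ContinuousOn P (baseInterval b₀) :=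
    fun t ht => (hP t ht).continuousAt.continuousWithinAt
  obtain ⟨Q, hQ0, hQ⟩ := exists_antiderivative (isOpen_baseInterval b₀)
    (ordConnected_baseInterval b₀) (u := fun t => g t * Real.exp (P t))
    (hg.continuousOn.mul (Real.continuous_exp.comp_continuousOn hPc)) ht₀
  exact ⟨P, Q, fun t ht => ⟨hP t ht, hQ t ht⟩, hQ0⟩

end Antiderivatives

/-! ### The function `η` -/

section Eta

variable {b₀ : EReal} {f g P Q : ℝ → ℝ} {V : Set (ℝ × ℝ)} {p : ℝ × ℝ}

theorem contDiffAt_etaDen (hP : ContDiffAt ℝ ∞ P p.1) (hQ : ContDiffAt ℝ ∞ Q p.1) :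
    ContDiffAt ℝ ∞ (etaDen P Q) p := by
  have hP' : ContDiffAt ℝ ∞ (fun q : ℝ × ℝ => P q.1) p := hP.comp p contDiffAt_fst
  have hQ' : ContDiffAt ℝ ∞ (fun q : ℝ × ℝ => Q q.1) p := hQ.comp p contDiffAt_fst
  unfold etaDen
  fun_prop

theorem IsRegion.contDiffOn_eta (hV : IsRegion b₀ P Q V) (hPQ : IsAntiderivPair b₀ f g P Q)
    (hf : ContDiffOn ℝ ∞ f (baseInterval b₀)) (hg : ContDiffOn ℝ ∞ g (baseInterval b₀)) :
    ContDiffOn ℝ ∞ (eta P Q) V := by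
  intro p hp
  have hb := (isOpen_baseInterval b₀).mem_nhds (fst_mem_baseInterval (hV.subset hp))
  obtain ⟨hP, hQ⟩ := hPQ.contDiffOn hf hg
  exact (ContDiffAt.div (by fun_prop) (contDiffAt_etaDen (hP.contDiffAt hb) (hQ.contDiffAt hb))
    (hV.den_ne_zero p hp)).contDiffWithinAt

theorem hasDerivAt_eta_snd (hd : etaDen P Q p ≠ 0) :
    HasDerivAt (fun s => eta P Q (p.1, s))
      (-2 * p.2 * Real.exp (P p.1) / etaDen P Q p ^ 2) p.2 := by
  have hu : HasDerivAt (fun s : ℝ => p.1 - s ^ 2) (-(2 * p.2)) p.2 := by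
    simpa using (hasDerivAt_pow 2 p.2).const_sub p.1
  have h := hu.div ((hu.mul_const (Q p.1)).const_sub (Real.exp (P p.1))) hd
  refine h.congr_deriv ?_
  simp only [etaDen] at hd ⊢
  field_simp
  ring

/-- This is where the choice of `P` and `Q` matters. With `u = t - s²`, the numerator of the
quotient rule collapses to `e^P (1 - u (f + g t) + u² g)`, and `t - u = s²`. -/
theorem hasDerivAt_eta_fst (hP : HasDerivAt P (f p.1 + g p.1 * p.1) p.1)
    (hQ : HasDerivAt Q (g p.1 * Real.exp (P p.1)) p.1) (hd : etaDen P Q p ≠ 0) :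
    HasDerivAt (fun t => eta P Q (t, p.2))
      (Real.exp (P p.1) * (1 - (f p.1 + g p.1 * p.2 ^ 2) * (p.1 - p.2 ^ 2)) / etaDen P Q p ^ 2)
      p.1 := by
  have hu : HasDerivAt (fun t : ℝ => t - p.2 ^ 2) 1 p.1 := (hasDerivAt_id p.1).sub_const _
  have h := hu.div (hP.exp.sub (hu.mul hQ)) hd
  refine h.congr_deriv ?_
  simp only [etaDen] at hd ⊢
  simp only [Pi.mul_apply, Pi.sub_apply]
  field_simp
  ring

/-- `η` is open already along vertical lines: its `s`-derivative is a nonzero multiple of `s`, so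
the one-variable inverse function theorem applies. -/
theorem IsRegion.image_eta_mem_nhds (hV : IsRegion b₀ P Q V) (hp : p ∈ V) {N : Set (ℝ × ℝ)}
    (hN : N ∈ 𝓝 p) : eta P Q '' N ∈ 𝓝 (eta P Q p) := by
  have hd := hV.den_ne_zero p hp
  have hs := hV.ne_zero p hp
  have hc : ContDiffAt ℝ ∞ (fun s => eta P Q (p.1, s)) p.2 := by
    have hden : ContDiffAt ℝ ∞ (fun s => Real.exp (P p.1) - (p.1 - s ^ 2) * Q p.1) p.2 := by
      fun_prop
    exact ContDiffAt.div (by fun_prop) hden hd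
  have hstrict : HasStrictDerivAt (fun s => eta P Q (p.1, s))
      (-2 * p.2 * Real.exp (P p.1) / etaDen P Q p ^ 2) p.2 :=
    hc.hasStrictDerivAt' (hasDerivAt_eta_snd hd) (by simp)
  have hmap := hstrict.map_nhds_eq (by positivity)
  have hcont : Tendsto (fun s : ℝ => (p.1, s)) (𝓝 p.2) (𝓝 p) :=
    (Continuous.prodMk_right p.1).tendsto p.2
  change eta P Q '' N ∈ 𝓝 (eta P Q (p.1, p.2))
  rw [← hmap]
  exact mem_map.2 (mem_of_superset (hcont hN) fun s hs => mem_image_of_mem _ hs)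

theorem IsRegion.isOpen_image_eta (hV : IsRegion b₀ P Q V) : IsOpen (eta P Q '' V) := by
  rw [isOpen_iff_mem_nhds]
  rintro _ ⟨p, hp, rfl⟩
  exact hV.image_eta_mem_nhds hp (hV.isOpen.mem_nhds hp)

end Eta

/-! ### The transport equation -/

section Transport

variable {b₀ : EReal} {f g P Q : ℝ → ℝ} {V : Set (ℝ × ℝ)} {p : ℝ × ℝ} {φ : ℝ → ℝ → ℝ}

/-- The combination `√(t - s²) (φ - s φ₂)`. -/
noncomputable def transportFn (φ : ℝ → ℝ → ℝ) (p : ℝ × ℝ) : ℝ :=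
  √(p.1 - p.2 ^ 2) * (φ p.1 p.2 - p.2 * D2 φ p.1 p.2)

/-- The linear first order equation satisfied by `√(t - s²) (φ - s φ₂)` and by `η`. -/
def Transported (f g : ℝ → ℝ) (w : ℝ × ℝ → ℝ) (p : ℝ × ℝ) : Prop :=
  fderiv ℝ w p (0, 1) * (1 - (f p.1 + g p.1 * p.2 ^ 2) * (p.1 - p.2 ^ 2))
    + 2 * p.2 * fderiv ℝ w p (1, 0) = 0

theorem contDiffOn_transportFn (hV : IsOpen V) (hVu : ∀ p ∈ V, p.2 ^ 2 < p.1)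
    (hφ : ContDiffOn ℝ ∞ (uncurry φ) V) : ContDiffOn ℝ ∞ (transportFn φ) V := by
  have h1 : ContDiffOn ℝ ∞ (fun p : ℝ × ℝ => √(p.1 - p.2 ^ 2)) V := fun p hp =>
    (ContDiffAt.sqrt (f := fun p : ℝ × ℝ => p.1 - p.2 ^ 2) (by fun_prop)
      (sub_pos.2 (hVu p hp)).ne').contDiffWithinAt
  exact h1.mul (hφ.sub (contDiffOn_snd.mul (contDiffOn_D2 hV hφ)))

/-- The transport expression of `w` equals `-s √(t - s²)` times the difference of the two sides of
the second-order equation. Indeed `(φ - s φ₂)_s = -s φ₂₂` and `(φ - s φ₂)_t = φ₁ - s φ₁₂`, while the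
root contributes the term `φ - s φ₂`. -/
theorem transported_transportFn_iff (hV : IsOpen V) (hVu : ∀ p ∈ V, p.2 ^ 2 < p.1)
    (hφ : ContDiffOn ℝ ∞ (uncurry φ) V) (hp : p ∈ V) (hs : p.2 ≠ 0) :
    Transported f g (transportFn φ) p ↔ DouglasPDE f g φ p.1 p.2 := by
  have hu : 0 < p.1 - p.2 ^ 2 := sub_pos.2 (hVu p hp)
  have hw := differentiableAt_of_smooth hV (contDiffOn_transportFn hV hVu hφ) hp
  have hφp := differentiableAt_of_smooth hV hφ hp
  have hφ2p := differentiableAt_of_smooth hV (contDiffOn_D2 hV hφ) hp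
  have e1 : fderiv ℝ (transportFn φ) p (1, 0)
      = 1 / (2 * √(p.1 - p.2 ^ 2)) * (φ p.1 p.2 - p.2 * D2 φ p.1 p.2)
        + √(p.1 - p.2 ^ 2) * (D1 φ p.1 p.2 - p.2 * D2 (D1 φ) p.1 p.2) := by
    rw [← D1_D2_comm hV hφ hp]
    have hu1 : HasDerivAt (fun t : ℝ => t - p.2 ^ 2) 1 p.1 := (hasDerivAt_id p.1).sub_const _
    exact (hasDerivAt_fst hw).unique ((hu1.sqrt hu.ne').mul
      ((hasDerivAt_D1 hφp).sub ((hasDerivAt_D1 hφ2p).const_mul p.2)))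
  have e2 : fderiv ℝ (transportFn φ) p (0, 1)
      = -(2 * p.2) / (2 * √(p.1 - p.2 ^ 2)) * (φ p.1 p.2 - p.2 * D2 φ p.1 p.2)
        + √(p.1 - p.2 ^ 2) * (D2 φ p.1 p.2
          - (1 * D2 φ p.1 p.2 + p.2 * D2 (D2 φ) p.1 p.2)) := by
    have hu2 : HasDerivAt (fun s : ℝ => p.1 - s ^ 2) (-(2 * p.2)) p.2 := by
      simpa using (hasDerivAt_pow 2 p.2).const_sub p.1
    exact (hasDerivAt_snd hw).unique ((hu2.sqrt hu.ne').mul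
      ((hasDerivAt_D2 hφp).sub ((hasDerivAt_id p.2).mul (hasDerivAt_D2 hφ2p))))
  have hr : 0 < √(p.1 - p.2 ^ 2) := Real.sqrt_pos.2 hu
  have hrr := Real.sq_sqrt hu.le
  unfold Transported DouglasPDE
  rw [e1, e2, ← sub_eq_zero (b := (f p.1 + g p.1 * p.2 ^ 2) * _)]
  generalize √(p.1 - p.2 ^ 2) = r at hr hrr
  rw [← hrr]
  have key : ∀ a b : ℝ, (∃ c, c ≠ 0 ∧ a = c * b) → (a = 0 ↔ b = 0) := by
    rintro a b ⟨c, hc, rfl⟩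
    simp [hc]
  refine key _ _ ⟨-(p.2 * r), by simp [hs, hr.ne'], ?_⟩
  field_simp
  ring

theorem fderiv_eta_snd (hη : DifferentiableAt ℝ (eta P Q) p) (hd : etaDen P Q p ≠ 0) :
    fderiv ℝ (eta P Q) p (0, 1) = -2 * p.2 * Real.exp (P p.1) / etaDen P Q p ^ 2 :=
  (hasDerivAt_snd hη).unique (hasDerivAt_eta_snd hd)

theorem IsRegion.transported_eta (hV : IsRegion b₀ P Q V) (hPQ : IsAntiderivPair b₀ f g P Q)
    (hη : DifferentiableAt ℝ (eta P Q) p) (hp : p ∈ V) : Transported f g (eta P Q) p := by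
  have hd := hV.den_ne_zero p hp
  obtain ⟨hP, hQ⟩ := hPQ p.1 (fst_mem_baseInterval (hV.subset hp))
  unfold Transported
  rw [fderiv_eta_snd hη hd, (hasDerivAt_fst hη).unique (hasDerivAt_eta_fst hP hQ hd)]
  field_simp
  ring

/-- The equation is homogeneous in the first derivatives, so the chain rule multiplies it by
`Φ'(w)`. -/
theorem Transported.comp {w : ℝ × ℝ → ℝ} {Φ : ℝ → ℝ} (h : Transported f g w p)
    (hw : DifferentiableAt ℝ w p) (hΦ : DifferentiableAt ℝ Φ (w p)) :
    Transported f g (fun q => Φ (w q)) p := by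
  have : fderiv ℝ (fun q => Φ (w q)) p = deriv Φ (w p) • fderiv ℝ w p :=
    (hΦ.hasDerivAt.comp_hasFDerivAt p hw.hasFDerivAt).fderiv
  unfold Transported at h ⊢
  rw [this]
  simp only [smul_apply, smul_eq_mul]
  linear_combination deriv Φ (w p) * h

theorem Transported.congr {w w' : ℝ × ℝ → ℝ} (h : Transported f g w p) (he : w' =ᶠ[𝓝 p] w) :
    Transported f g w' p := by
  unfold Transported at h ⊢
  rwa [he.fderiv_eq]

end Transport

/-! ### Factoring solutions of the transport equation through `η` -/

section Factor

variable {b₀ : EReal} {f g P Q : ℝ → ℝ} {V : Set (ℝ × ℝ)} {p₀ : ℝ × ℝ}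

/-- The value of `s` with the sign of `ε` and `η(t, s) = r`, as a function of `(t, r)`. -/
noncomputable def etaInverse (P Q : ℝ → ℝ) (ε : ℝ) (q : ℝ × ℝ) : ℝ :=
  ε * √(q.1 - q.2 * Real.exp (P q.1) / (1 + q.2 * Q q.1))

/-- This and the next two lemmas invert `η` in `s`: `η = r` means `(t - s²)(1 + r Q) = r e^P`, and
`1 + r Q` does not vanish when `r` is a value of `η`. -/
theorem one_add_eta_mul {p : ℝ × ℝ} (hd : etaDen P Q p ≠ 0) :
    1 + eta P Q p * Q p.1 = Real.exp (P p.1) / etaDen P Q p := by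
  unfold eta
  field_simp
  simp only [etaDen]
  ring

theorem sub_eta_mul_exp_div {p : ℝ × ℝ} (hd : etaDen P Q p ≠ 0) :
    p.1 - eta P Q p * Real.exp (P p.1) / (1 + eta P Q p * Q p.1) = p.2 ^ 2 := by
  rw [one_add_eta_mul hd]
  unfold eta
  field_simp
  ring

theorem eta_of_sq_eq {p : ℝ × ℝ} {r : ℝ} (hr : 1 + r * Q p.1 ≠ 0)
    (h : p.2 ^ 2 = p.1 - r * Real.exp (P p.1) / (1 + r * Q p.1)) : eta P Q p = r := by
  have hden : etaDen P Q p = Real.exp (P p.1) / (1 + r * Q p.1) := by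
    unfold etaDen
    rw [h]
    field_simp
    ring
  unfold eta
  rw [hden, h]
  field_simp
  ring

/-- A function satisfying the transport equation is locally a smooth function of `η`. -/
theorem IsRegion.exists_local_factor (hV : IsRegion b₀ P Q V)
    (hPQ : IsAntiderivPair b₀ f g P Q) (hf : ContDiffOn ℝ ∞ f (baseInterval b₀))
    (hg : ContDiffOn ℝ ∞ g (baseInterval b₀)) {w : ℝ × ℝ → ℝ} (hw : ContDiffOn ℝ ∞ w V)
    (htr : ∀ p ∈ V, Transported f g w p) (hp₀ : p₀ ∈ V) :
    ∃ Φ : ℝ → ℝ, ∃ O : Set ℝ, IsOpen O ∧ eta P Q p₀ ∈ O ∧ ContDiffOn ℝ ∞ Φ O ∧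
      ∀ᶠ p in 𝓝 p₀, w p = Φ (eta P Q p) := by
  obtain ⟨hP, hQ⟩ := hPQ.contDiffOn hf hg
  have hηs := hV.contDiffOn_eta hPQ hf hg
  have hd₀ := hV.den_ne_zero p₀ hp₀
  have hs₀ := hV.ne_zero p₀ hp₀
  -- `η` determines only `s²`; the sign of `s` at the base point selects the branch of the root.
  set ε : ℝ := ((SignType.sign p₀.2 : SignType) : ℝ) with hε
  have hε2 : ε ^ 2 = 1 := by
    rcases lt_or_gt_of_ne hs₀ with h | h <;> simp [hε, h]
  set r₀ := eta P Q p₀ with hr₀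
  set q₀ : ℝ × ℝ := (p₀.1, r₀) with hq₀
  let G : Set (ℝ × ℝ) := {q | q.1 ∈ baseInterval b₀ ∧ 1 + q.2 * Q q.1 ≠ 0 ∧
    0 < q.1 - q.2 * Real.exp (P q.1) / (1 + q.2 * Q q.1)}
  have hsmooth : ∀ q ∈ G, ContDiffAt ℝ ∞ (etaInverse P Q ε) q := by
    rintro q ⟨h1, h2, h3⟩
    have hb := (isOpen_baseInterval b₀).mem_nhds h1
    have hP' : ContDiffAt ℝ ∞ (fun q : ℝ × ℝ => P q.1) q :=
      (hP.contDiffAt hb).comp q contDiffAt_fst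
    have hQ' : ContDiffAt ℝ ∞ (fun q : ℝ × ℝ => Q q.1) q :=
      (hQ.contDiffAt hb).comp q contDiffAt_fst
    refine contDiffAt_const.mul (ContDiffAt.sqrt ?_ h3.ne')
    exact contDiffAt_fst.sub ((contDiffAt_snd.mul hP'.exp).div
      (contDiffAt_const.add (contDiffAt_snd.mul hQ')) h2)
  have hGo : ∀ q ∈ G, G ∈ 𝓝 q := by
    rintro q ⟨h1, h2, h3⟩
    have hb := (isOpen_baseInterval b₀).mem_nhds h1
    have hP' : ContinuousAt (fun q : ℝ × ℝ => P q.1) q :=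
      ContinuousAt.comp (f := Prod.fst) (hP.contDiffAt hb).continuousAt continuousAt_fst
    have hQ' : ContinuousAt (fun q : ℝ × ℝ => Q q.1) q :=
      ContinuousAt.comp (f := Prod.fst) (hQ.contDiffAt hb).continuousAt continuousAt_fst
    have hden : ContinuousAt (fun q : ℝ × ℝ => 1 + q.2 * Q q.1) q :=
      continuousAt_const.add (continuousAt_snd.mul hQ')
    have hE : ContinuousAt (fun q : ℝ × ℝ => Real.exp (P q.1)) q :=
      Real.continuous_exp.continuousAt.comp hP'
    have hrad := continuousAt_fst.sub ((continuousAt_snd.mul hE).div hden h2)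
    filter_upwards [continuousAt_fst.preimage_mem_nhds hb, hden.eventually_ne h2,
      hrad.eventually_const_lt h3] with q' a b c using ⟨a, b, c⟩
  have hsq₀ : p₀.1 - r₀ * Real.exp (P p₀.1) / (1 + r₀ * Q p₀.1) = p₀.2 ^ 2 :=
    sub_eta_mul_exp_div hd₀
  have hG₀ : q₀ ∈ G := by
    have hb₀ := fst_mem_baseInterval (hV.subset hp₀)
    refine ⟨hb₀, ?_, ?_⟩
    · change 1 + eta P Q p₀ * Q p₀.1 ≠ 0
      rw [one_add_eta_mul hd₀]
      exact div_ne_zero (Real.exp_ne_zero _) hd₀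
    · change 0 < p₀.1 - r₀ * Real.exp (P p₀.1) / (1 + r₀ * Q p₀.1)
      rw [hsq₀]
      positivity
  have hinv₀ : etaInverse P Q ε q₀ = p₀.2 := by
    change ε * √(p₀.1 - r₀ * Real.exp (P p₀.1) / (1 + r₀ * Q p₀.1)) = p₀.2
    rw [hsq₀, Real.sqrt_sq_eq_abs, hε, sign_mul_abs]
  -- The change of coordinates from `(t, r)`, with `r = η`, back to `(t, s)`; it turns the
  -- characteristics into lines of constant `r`.
  let m : ℝ × ℝ → ℝ × ℝ := fun q => (q.1, etaInverse P Q ε q)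
  have hm₀ : m q₀ = p₀ := Prod.ext rfl hinv₀
  have hms : ∀ q ∈ G, ContDiffAt ℝ ∞ m q := fun q hq => contDiffAt_fst.prodMk (hsmooth q hq)
  have hmV : ∀ᶠ q in 𝓝 q₀, q ∈ G ∧ m q ∈ V :=
    Filter.Eventually.and (hGo q₀ hG₀)
      ((hms q₀ hG₀).continuousAt.preimage_mem_nhds (hm₀.symm ▸ hV.isOpen.mem_nhds hp₀))
  obtain ⟨δ, hδ, hball⟩ := Metric.eventually_nhds_iff_ball.1 hmV
  have hηm : ∀ q ∈ G, eta P Q (m q) = q.2 := by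
    rintro q ⟨h1, h2, h3⟩
    refine eta_of_sq_eq (p := m q) h2 ?_
    change (ε * √(q.1 - q.2 * Real.exp (P q.1) / (1 + q.2 * Q q.1))) ^ 2 = _
    rw [mul_pow, hε2, one_mul, Real.sq_sqrt h3.le]
  -- A ball of the sup metric is a product, so the segment in `t` at fixed `r` stays inside.
  have hbox : ∀ t ∈ Metric.ball p₀.1 δ, ∀ r ∈ Metric.ball r₀ δ, (t, r) ∈ Metric.ball q₀ δ := by
    intro t ht r hr
    rw [← ball_prod_same]
    exact ⟨ht, hr⟩
  have hderiv : ∀ q ∈ Metric.ball q₀ δ, HasDerivAt (fun t => w (m (t, q.2))) 0 q.1 := by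
    intro q hq
    obtain ⟨hqG, hqV⟩ := hball q hq
    have hmd : DifferentiableAt ℝ m q := (hms q hqG).differentiableAt (by simp)
    have h1 := hasDerivAt_fst ((hsmooth q hqG).differentiableAt (by simp))
    set σ' := fderiv ℝ (etaInverse P Q ε) q (1, 0)
    have hmder : HasDerivAt (fun t => m (t, q.2)) ((1 : ℝ), σ') q.1 := (hasDerivAt_id q.1).prodMk h1
    have hsplit : ∀ L : ℝ × ℝ →L[ℝ] ℝ, L (1, σ') = L (1, 0) + σ' * L (0, 1) := fun L => by
      rw [← smul_eq_mul, ← map_smul, ← map_add]; simp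
    have hηd : DifferentiableAt ℝ (eta P Q) (m q) := differentiableAt_of_smooth hV.isOpen hηs hqV
    have hwd : DifferentiableAt ℝ w (m q) := differentiableAt_of_smooth hV.isOpen hw hqV
    have h2 := HasFDerivAt.comp_hasDerivAt (f := fun t => m (t, q.2)) q.1 hηd.hasFDerivAt hmder
    have h3 := HasFDerivAt.comp_hasDerivAt (f := fun t => m (t, q.2)) q.1 hwd.hasFDerivAt hmder
    have h4 : (eta P Q ∘ fun t => m (t, q.2)) =ᶠ[𝓝 q.1] fun _ => q.2 := by
      have hc : Tendsto (fun t : ℝ => (t, q.2)) (𝓝 q.1) (𝓝 q) :=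
        (Continuous.prodMk_left q.2).tendsto q.1
      filter_upwards [hc (hGo q hqG)] with t ht using hηm _ ht
    -- `η` is constant along the curve, which gives `η_t + σ' η_s = 0`.
    have h5 := (h2.congr_of_eventuallyEq h4.symm).unique (hasDerivAt_const q.1 q.2)
    rw [hsplit] at h5 h3
    have hdm := hV.den_ne_zero _ hqV
    have hsm := hV.ne_zero _ hqV
    have hη2 : fderiv ℝ (eta P Q) (m q) (0, 1) ≠ 0 := by
      rw [fderiv_eta_snd hηd hdm]
      positivity
    have tw := htr _ hqV
    have tη := hV.transported_eta hPQ hηd hqV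
    unfold Transported at tw tη
    refine h3.congr_deriv ?_
    have hne : 2 * (m q).2 * fderiv ℝ (eta P Q) (m q) (0, 1) ≠ 0 := by positivity
    refine (mul_eq_zero.1 ?_).resolve_left hne
    -- Both transport equations have the same coefficients. Cross-multiplying by `η_s` and `w_s`
    -- eliminates the one of `∂_s`, and `h5` eliminates `η_t`, leaving `2 s η_s (w_t + σ' w_s) = 0`.
    linear_combination fderiv ℝ (eta P Q) (m q) (0, 1) * tw
      - fderiv ℝ w (m q) (0, 1) * tη + 2 * (m q).2 * fderiv ℝ w (m q) (0, 1) * h5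
  -- In the coordinates `(t, r)` the function `w` does not depend on `t`, so its values over `t =
  -- t₀` give `Φ`.
  refine ⟨fun r => w (m (p₀.1, r)), Metric.ball r₀ δ, Metric.isOpen_ball,
    Metric.mem_ball_self hδ, ?_, ?_⟩
  · intro r hr
    obtain ⟨h1, h2⟩ := hball _ (hbox p₀.1 (Metric.mem_ball_self hδ) r hr)
    have hc : ContDiffAt ℝ ∞ (fun r : ℝ => m (p₀.1, r)) r :=
      (hms _ h1).comp r (contDiffAt_const.prodMk contDiffAt_id)
    exact ((hw.contDiffAt (hV.isOpen.mem_nhds h2)).comp r hc).contDiffWithinAt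
  · have hηc : ContinuousAt (eta P Q) p₀ :=
      (differentiableAt_of_smooth hV.isOpen hηs hp₀).continuousAt
    have hsign : ∀ᶠ p : ℝ × ℝ in 𝓝 p₀, ε * |p.2| = p.2 := by
      rcases lt_or_gt_of_ne hs₀ with h | h
      · filter_upwards [continuousAt_snd.eventually_lt_const h] with p hp
        simp [hε, h, abs_of_neg hp]
      · filter_upwards [continuousAt_snd.eventually_const_lt h] with p hp
        simp [hε, h, abs_of_pos hp]
    filter_upwards [hsign, hV.isOpen.mem_nhds hp₀,
      continuousAt_fst.preimage_mem_nhds (Metric.ball_mem_nhds p₀.1 hδ),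
      hηc.preimage_mem_nhds (Metric.ball_mem_nhds r₀ hδ)] with p hpε hpV hp1 hpη
    have hmp : m (p.1, eta P Q p) = p := by
      refine Prod.ext rfl ?_
      change ε * √(p.1 - eta P Q p * Real.exp (P p.1) / (1 + eta P Q p * Q p.1)) = p.2
      rw [sub_eta_mul_exp_div (hV.den_ne_zero p hpV), Real.sqrt_sq_eq_abs, hpε]
    have hconst := IsOpen.is_const_of_deriv_eq_zero (𝕜 := ℝ)
      (f := fun t => w (m (t, eta P Q p))) Metric.isOpen_ball
      (convex_ball p₀.1 δ).isPreconnected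
      (fun t ht => (hderiv _ (hbox t ht _ hpη)).differentiableAt.differentiableWithinAt)
      (fun t ht => (hderiv _ (hbox t ht _ hpη)).deriv) hp1 (Metric.mem_ball_self hδ)
    rw [← hconst]
    simp only [hmp]

end Factor

/-! ### Solutions and the solution formula -/

section Solutions

variable {b₀ : EReal} {f g P Q : ℝ → ℝ} {V : Set (ℝ × ℝ)} {φ A : ℝ → ℝ → ℝ} {Φ h : ℝ → ℝ}

/-- For `φ = s (h - A)` the operator `φ - s φ₂` annihilates the part `s h(t)` and leaves `s² A_s`.
-/
theorem transportFn_of_solutionFormula (hV : IsRegion b₀ P Q V) (hA : IsIntegral P Q Φ A V)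
    (hφ : SolutionFormula h A φ V) {p : ℝ × ℝ} (hp : p ∈ V) :
    transportFn φ p = Φ (eta P Q p) := by
  have hs := hV.ne_zero p hp
  have hu : 0 < p.1 - p.2 ^ 2 := sub_pos.2 (hV.subset hp).1
  have he : (fun s => φ p.1 s) =ᶠ[𝓝 p.2] fun s => s * (h p.1 - A p.1 s) := by
    have hc : Tendsto (fun s : ℝ => (p.1, s)) (𝓝 p.2) (𝓝 p) :=
      (Continuous.prodMk_right p.1).tendsto p.2
    filter_upwards [hc (hV.isOpen.mem_nhds hp)] with s hs using hφ (p.1, s) hs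
  have hd := ((hasDerivAt_id p.2).mul ((hA.2 p hp).const_sub (h p.1))).congr_of_eventuallyEq he
  have hD2 : D2 φ p.1 p.2 = _ := hd.deriv
  have hr : √(p.1 - p.2 ^ 2) ≠ 0 := (Real.sqrt_pos.2 hu).ne'
  unfold transportFn
  rw [hD2, hφ p hp]
  simp only [id]
  field_simp
  ring

theorem solution_of_formula (hf : ContDiffOn ℝ ∞ f (baseInterval b₀))
    (hg : ContDiffOn ℝ ∞ g (baseInterval b₀)) (hPQ : IsAntiderivPair b₀ f g P Q)
    (hV : IsRegion b₀ P Q V) (hΦ : ContDiffOn ℝ ∞ Φ (eta P Q '' V))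
    (hh : ContDiffOn ℝ ∞ h (Prod.fst '' V)) (hA : IsIntegral P Q Φ A V)
    (hφ : SolutionFormula h A φ V) :
    ContDiffOn ℝ ∞ (uncurry φ) V ∧ ∀ p ∈ V, DouglasPDE f g φ p.1 p.2 := by
  have hsm : ContDiffOn ℝ ∞ (uncurry φ) V := by
    have h1 : ContDiffOn ℝ ∞ (fun p : ℝ × ℝ => h p.1) V :=
      hh.comp contDiffOn_fst (mapsTo_image _ _)
    exact (contDiffOn_snd.mul (h1.sub hA.1)).congr fun p hp => hφ p hp
  refine ⟨hsm, fun p hp => ?_⟩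
  rw [← transported_transportFn_iff hV.isOpen (fun q hq => (hV.subset hq).1) hsm hp
    (hV.ne_zero p hp)]
  have hηd := differentiableAt_of_smooth hV.isOpen (hV.contDiffOn_eta hPQ hf hg) hp
  have hΦd : DifferentiableAt ℝ Φ (eta P Q p) :=
    (hΦ.contDiffAt (hV.isOpen_image_eta.mem_nhds (mem_image_of_mem _ hp))).differentiableAt
      (by simp)
  refine ((hV.transported_eta hPQ hηd hp).comp hηd hΦd).congr ?_
  filter_upwards [hV.isOpen.mem_nhds hp] with q hq using transportFn_of_solutionFormula hV hA hφ hq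

/-- If `√(t - s²) (φ - s φ₂) = Φ(η)`, then `-φ / s` is one of the indefinite integrals. -/
theorem isIntegral_neg_div (hV : IsRegion b₀ P Q V) (hφ : ContDiffOn ℝ ∞ (uncurry φ) V)
    (hw : ∀ p ∈ V, transportFn φ p = Φ (eta P Q p)) :
    IsIntegral P Q Φ (fun t s => -(φ t s / s)) V := by
  refine ⟨(hφ.div contDiffOn_snd hV.ne_zero).neg, fun p hp => ?_⟩
  have hs := hV.ne_zero p hp
  have hu : 0 < p.1 - p.2 ^ 2 := sub_pos.2 (hV.subset hp).1
  have hr : √(p.1 - p.2 ^ 2) ≠ 0 := (Real.sqrt_pos.2 hu).ne'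
  have hd := ((hasDerivAt_D2 (differentiableAt_of_smooth hV.isOpen hφ hp)).div
    (hasDerivAt_id p.2) hs).neg
  refine hd.congr_deriv ?_
  rw [← hw p hp]
  unfold transportFn
  simp only [id]
  field_simp
  ring

/-- This is a tautology; the content lies in `-φ / s` being an indefinite integral, and the constant
of integration can then be taken to be zero. -/
theorem solutionFormula_neg_div (hV : IsRegion b₀ P Q V) :
    SolutionFormula 0 (fun t s => -(φ t s / s)) φ V := by
  intro p hp
  have hs := hV.ne_zero p hp
  simp only [Pi.zero_apply]
  field_simp
  ring

/-- On a connected level set of `η` the locally constant `transportFn φ` is constant, so one `Φ`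
serves all of `V`. Any admissible `A` differs from `-φ / s` by a function with zero `s`-derivative,
which on connected sections depends on `t` only. -/
theorem exists_formula_of_solution (hf : ContDiffOn ℝ ∞ f (baseInterval b₀))
    (hg : ContDiffOn ℝ ∞ g (baseInterval b₀)) (hPQ : IsAntiderivPair b₀ f g P Q)
    (hV : IsRegion b₀ P Q V) (hlev : ∀ r : ℝ, IsPreconnected {p | p ∈ V ∧ eta P Q p = r})
    (hsec : ∀ t : ℝ, IsPreconnected {s : ℝ | (t, s) ∈ V})
    (hφ : ContDiffOn ℝ ∞ (uncurry φ) V) (hpde : ∀ p ∈ V, DouglasPDE f g φ p.1 p.2) :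
    ∃ Φ : ℝ → ℝ, ContDiffOn ℝ ∞ Φ (eta P Q '' V) ∧
      (∃ A : ℝ → ℝ → ℝ, IsIntegral P Q Φ A V) ∧
      ∀ A : ℝ → ℝ → ℝ, IsIntegral P Q Φ A V →
        ∃ h : ℝ → ℝ, ContDiffOn ℝ ∞ h (Prod.fst '' V) ∧ SolutionFormula h A φ V := by
  classical
  have hVu : ∀ p ∈ V, p.2 ^ 2 < p.1 := fun q hq => (hV.subset hq).1
  have hw := contDiffOn_transportFn hV.isOpen hVu hφ
  have htr : ∀ p ∈ V, Transported f g (transportFn φ) p := fun p hp =>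
    (transported_transportFn_iff hV.isOpen hVu hφ hp (hV.ne_zero p hp)).2 (hpde p hp)
  have hloc := fun p hp => hV.exists_local_factor hPQ hf hg hw htr (p₀ := p) hp
  have hlevel : ∀ p ∈ V, ∀ q ∈ V, eta P Q p = eta P Q q → transportFn φ p = transportFn φ q := by
    intro p hp q hq hpq
    let S := {x | x ∈ V ∧ eta P Q x = eta P Q q}
    have hS : IsPreconnected S := hlev _
    have : PreconnectedSpace S := Subtype.preconnectedSpace hS
    have hlc : IsLocallyConstant fun x : S => transportFn φ x := by
      rw [IsLocallyConstant.iff_eventually_eq]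
      intro x
      obtain ⟨Φ, O, -, -, -, he⟩ := hloc x x.2.1
      filter_upwards [continuous_subtype_val.continuousAt.eventually he] with y hy
      rw [hy, he.self_of_nhds, y.2.2, x.2.2]
    exact hlc.apply_eq_of_preconnectedSpace ⟨p, hp, hpq⟩ ⟨q, hq, rfl⟩
  let Φ : ℝ → ℝ := fun r => if hr : ∃ p ∈ V, eta P Q p = r then transportFn φ hr.choose else 0
  have hΦw : ∀ p ∈ V, transportFn φ p = Φ (eta P Q p) := by
    intro p hp
    have hr : ∃ q ∈ V, eta P Q q = eta P Q p := ⟨p, hp, rfl⟩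
    simp only [Φ, dif_pos hr]
    exact hlevel p hp _ hr.choose_spec.1 hr.choose_spec.2.symm
  refine ⟨Φ, ?_, ⟨_, isIntegral_neg_div hV hφ hΦw⟩, fun A hA => ?_⟩
  · rintro _ ⟨p, hp, rfl⟩
    obtain ⟨Φ', O, hO, hpO, hΦ', he⟩ := hloc p hp
    refine ((hΦ'.contDiffAt (hO.mem_nhds hpO)).congr_of_eventuallyEq ?_).contDiffWithinAt
    -- `η` maps this neighbourhood onto a neighbourhood of `η(p)`, where the pointwise chosen `Φ`
    -- therefore coincides with the smooth `Φ'`.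
    have hN : {q | transportFn φ q = Φ' (eta P Q q)} ∩ V ∈ 𝓝 p :=
      inter_mem he (hV.isOpen.mem_nhds hp)
    filter_upwards [hV.image_eta_mem_nhds hp hN]
    rintro _ ⟨q, ⟨hq, hqV⟩, rfl⟩
    rw [← hΦw q hqV, hq]
  · have hB := isIntegral_neg_div hV hφ hΦw
    have hconst : ∀ t s s', (t, s) ∈ V → (t, s') ∈ V →
        φ t s / s + A t s = φ t s' / s' + A t s' := by
      intro t s s' hs hs'
      have hd : ∀ x ∈ {s : ℝ | (t, s) ∈ V}, HasDerivAt (fun s => φ t s / s + A t s) 0 x := by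
        intro x hx
        have h1 := (hA.2 (t, x) hx).sub (hB.2 (t, x) hx)
        refine (h1.congr_deriv (sub_self _)).congr_of_eventuallyEq
          (Eventually.of_forall fun s => ?_)
        simp only [Pi.sub_apply]
        ring
      exact IsOpen.is_const_of_deriv_eq_zero (𝕜 := ℝ)
        (hV.isOpen.preimage (Continuous.prodMk_right t)) (hsec t)
        (fun x hx => (hd x hx).differentiableAt.differentiableWithinAt)
        (fun x hx => (hd x hx).deriv) hs hs'
    let h : ℝ → ℝ := fun t =>
      if ht : ∃ s, (t, s) ∈ V then φ t ht.choose / ht.choose + A t ht.choose else 0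
    have hh : ∀ t s, (t, s) ∈ V → h t = φ t s / s + A t s := by
      intro t s hs
      have ht : ∃ s, (t, s) ∈ V := ⟨s, hs⟩
      simp only [h, dif_pos ht]
      exact hconst t _ _ ht.choose_spec hs
    refine ⟨h, ?_, ?_⟩
    -- Near `p.1` the chosen values can be replaced by those on the horizontal line `s = p.2`, along
    -- which the expression is smooth.
    · rintro _ ⟨p, hp, rfl⟩
      have hsm : ContDiffAt ℝ ∞ (fun q : ℝ × ℝ => φ q.1 q.2 / q.2 + A q.1 q.2) p :=
        ((hφ.div contDiffOn_snd hV.ne_zero).add hA.1).contDiffAt (hV.isOpen.mem_nhds hp)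
      have hc : Tendsto (fun t : ℝ => (t, p.2)) (𝓝 p.1) (𝓝 p) :=
        (Continuous.prodMk_left p.2).tendsto p.1
      refine (ContDiffAt.congr_of_eventuallyEq
        (ContDiffAt.comp (f := fun t : ℝ => (t, p.2)) p.1 hsm
          (contDiffAt_id.prodMk contDiffAt_const)) ?_).contDiffWithinAt
      filter_upwards [hc (hV.isOpen.mem_nhds hp)] with t ht using hh t p.2 ht
    · intro p hp
      have hs := hV.ne_zero p hp
      rw [hh p.1 p.2 hp]
      field_simp
      ring

theorem continuousOn_of_pde_side {U : Set (ℝ × ℝ)} (hU : IsOpen U) (hUΩ : U ⊆ openDomain b₀)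
    (hf : ContDiffOn ℝ ∞ f (baseInterval b₀)) (hg : ContDiffOn ℝ ∞ g (baseInterval b₀))
    (hφ : ContDiffOn ℝ ∞ (uncurry φ) U) :
    ContinuousOn (fun p : ℝ × ℝ => D2 (D2 φ) p.1 p.2
      - 2 * (D1 φ p.1 p.2 - p.2 * D2 (D1 φ) p.1 p.2)
      - (f p.1 + g p.1 * p.2 ^ 2) * (φ p.1 p.2 - p.2 * D2 φ p.1 p.2
        + (p.1 - p.2 ^ 2) * D2 (D2 φ) p.1 p.2)) U := by
  have h0 : ContinuousOn (fun p : ℝ × ℝ => φ p.1 p.2) U := hφ.continuousOn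
  have h1 : ContinuousOn (fun p : ℝ × ℝ => D1 φ p.1 p.2) U := (contDiffOn_D1 hU hφ).continuousOn
  have h2 : ContinuousOn (fun p : ℝ × ℝ => D2 φ p.1 p.2) U := (contDiffOn_D2 hU hφ).continuousOn
  have h12 : ContinuousOn (fun p : ℝ × ℝ => D2 (D1 φ) p.1 p.2) U :=
    (contDiffOn_D2 hU (contDiffOn_D1 hU hφ)).continuousOn
  have h22 : ContinuousOn (fun p : ℝ × ℝ => D2 (D2 φ) p.1 p.2) U :=
    (contDiffOn_D2 hU (contDiffOn_D2 hU hφ)).continuousOn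
  have hf' : ContinuousOn (fun p : ℝ × ℝ => f p.1) U :=
    hf.continuousOn.comp continuousOn_fst fun p hp => fst_mem_baseInterval (hUΩ hp)
  have hg' : ContinuousOn (fun p : ℝ × ℝ => g p.1) U :=
    hg.continuousOn.comp continuousOn_fst fun p hp => fst_mem_baseInterval (hUΩ hp)
  have hs : ContinuousOn (fun p : ℝ × ℝ => p.2) U := continuousOn_snd
  have ht : ContinuousOn (fun p : ℝ × ℝ => p.1) U := continuousOn_fst
  exact (h22.sub (continuousOn_const.mul (h1.sub (hs.mul h12)))).sub
    ((hf'.add (hg'.mul (hs.pow 2))).mul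
      ((h0.sub (hs.mul h2)).add ((ht.sub (hs.pow 2)).mul h22)))

/-- No connectedness is needed here, since a neighbourhood may be shrunk until a single local factor
`Φ` works on it. Conversely the formula gives the equation off `s = 0`, and both sides are
continuous. -/
theorem solution_iff_locallyOfSolutionForm {U : Set (ℝ × ℝ)} (hU : IsOpen U)
    (hUΩ : U ⊆ openDomain b₀) (hf : ContDiffOn ℝ ∞ f (baseInterval b₀))
    (hg : ContDiffOn ℝ ∞ g (baseInterval b₀)) (hφ : ContDiffOn ℝ ∞ (uncurry φ) U) :
    (∀ p ∈ U, DouglasPDE f g φ p.1 p.2) ↔ LocallyOfSolutionForm b₀ f g φ U := by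
  constructor
  · intro hpde p hp hs
    have hpb := fst_mem_baseInterval (hUΩ hp)
    obtain ⟨P, Q, hPQ, hQ0⟩ := exists_isAntiderivPair hf hg hpb
    obtain ⟨hP, hQ⟩ := hPQ.contDiffOn hf hg
    have hb := (isOpen_baseInterval b₀).mem_nhds hpb
    let V₀ : Set (ℝ × ℝ) := interior {q | q ∈ U ∧ q.2 ≠ 0 ∧ etaDen P Q q ≠ 0}
    have hV₀ : IsRegion b₀ P Q V₀ :=
      ⟨isOpen_interior, fun q hq => hUΩ (interior_subset hq).1,
        fun q hq => (interior_subset hq).2.1, fun q hq => (interior_subset hq).2.2⟩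
    have hV₀U : V₀ ⊆ U := fun q hq => (interior_subset hq).1
    have hpV₀ : p ∈ V₀ := by
      refine mem_interior_iff_mem_nhds.2 ?_
      have hd : etaDen P Q p ≠ 0 := by simp [etaDen, hQ0, Real.exp_ne_zero]
      have hdc : ContinuousAt (etaDen P Q) p :=
        (contDiffAt_etaDen (hP.contDiffAt hb) (hQ.contDiffAt hb)).continuousAt
      filter_upwards [hU.mem_nhds hp, continuousAt_snd.eventually_ne hs,
        hdc.eventually_ne hd] with q a b c using ⟨a, b, c⟩
    have hVu : ∀ p ∈ V₀, p.2 ^ 2 < p.1 := fun q hq => (hV₀.subset hq).1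
    obtain ⟨Φ, O, hO, hpO, hΦ, he⟩ := hV₀.exists_local_factor hPQ hf hg
      (contDiffOn_transportFn hV₀.isOpen hVu (hφ.mono hV₀U))
      (fun q hq => (transported_transportFn_iff hV₀.isOpen hVu (hφ.mono hV₀U) hq
        (hV₀.ne_zero q hq)).2 (hpde q (hV₀U hq))) hpV₀
    -- Shrinking makes the factorisation hold throughout `V` and keeps `η(V)` inside the set where
    -- `Φ` is smooth.
    let V : Set (ℝ × ℝ) := interior (V₀ ∩ ({q | transportFn φ q = Φ (eta P Q q)} ∩ eta P Q ⁻¹' O))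
    have hVV₀ : V ⊆ V₀ := fun q hq => (interior_subset hq).1
    have hV : IsRegion b₀ P Q V :=
      ⟨isOpen_interior, hVV₀.trans hV₀.subset, fun q hq => hV₀.ne_zero q (hVV₀ hq),
        fun q hq => hV₀.den_ne_zero q (hVV₀ hq)⟩
    have hpV : p ∈ V := by
      refine mem_interior_iff_mem_nhds.2 (inter_mem (hV₀.isOpen.mem_nhds hpV₀) (inter_mem he ?_))
      exact (differentiableAt_of_smooth hV₀.isOpen
        (hV₀.contDiffOn_eta hPQ hf hg) hpV₀).continuousAt.preimage_mem_nhds (hO.mem_nhds hpO)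
    refine ⟨P, Q, V, hPQ, hV, hpV, hVV₀.trans hV₀U, Φ, 0, fun t s => -(φ t s / s), ?_,
      contDiffOn_const, isIntegral_neg_div hV (hφ.mono (hVV₀.trans hV₀U))
        fun q hq => (interior_subset hq).2.1, solutionFormula_neg_div hV⟩
    refine hΦ.mono ?_
    rintro _ ⟨q, hq, rfl⟩
    exact (interior_subset hq).2.2
  · intro hloc
    have hne : ∀ p ∈ U, p.2 ≠ 0 → DouglasPDE f g φ p.1 p.2 := by
      intro p hp hs
      obtain ⟨P, Q, V, hPQ, hV, hpV, -, Φ, h, A, hΦ, hh, hA, hform⟩ := hloc p hp hs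
      exact (solution_of_formula hf hg hPQ hV hΦ hh hA hform).2 p hpV
    intro p hp
    by_cases hs : p.2 = 0
    swap
    · exact hne p hp hs
    have hcont := (continuousOn_of_pde_side hU hUΩ hf hg hφ).continuousAt (hU.mem_nhds hp)
    have hc : Tendsto (fun s : ℝ => (p.1, s)) (𝓝 p.2) (𝓝 p) :=
      (Continuous.prodMk_right p.1).tendsto p.2
    -- Approach the point along the punctured vertical line, on which the difference of the two
    -- sides is zero.
    have hlim := (hcont.tendsto.comp hc).mono_left (nhdsWithin_le_nhds (s := {p.2}ᶜ))
    refine sub_eq_zero.1 (tendsto_nhds_unique (hlim.congr' ?_) tendsto_const_nhds)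
    filter_upwards [nhdsWithin_le_nhds (hc (hU.mem_nhds hp)), self_mem_nhdsWithin] with s h1 h2
    exact sub_eq_zero.2 (hne (p.1, s) h1 (by simpa [hs] using h2))

end Solutions

/-! ### The equation of the geodesic coefficients, as an identity of linear algebra -/

section Algebra

variable {n : ℕ} {a : Matrix (Fin n) (Fin n) ℝ} {y Y b bu k Fy Fx G : Fin n → ℝ}
  {N Fyy dFx : Fin n → Fin n → ℝ} {Γ : Fin n → Fin n → Fin n → ℝ}
  {α t s c φ φ1 φ2 φ12 φ22 κ P : ℝ}

/-- This checks `[F²]_{x^k y^l} y^k - [F²]_{x^l} = 4 g_{li} G^i` for `F = αφ` with all derivatives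
replaced by their values; `Y` and `bu` are the lowered `y` and the raised `b`. The Christoffel terms
agree on both sides. Euler's relations `F_i y^i = F` and `F_{il} y^i = 0` reduce the contribution of
`P y^i` to a multiple of `F_l`. What remains is a multiple of `k_l`, the part of `b_l` that
annihilates `y`. -/
theorem spray_identity (hα : α ≠ 0) (hYy : ∑ i, Y i * y i = α ^ 2) (hby : ∑ i, b i * y i = s * α)
    (hbb : ∑ i, b i * bu i = t) (hYb : ∑ i, Y i * bu i = s * α)
    (haY : ∀ l, ∑ i, a i l * y i = Y l) (hab : ∀ l, ∑ i, a i l * bu i = b l)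
    (hΓ : ∀ i j l, Γ i j l = Γ i l j) (hN : ∀ i j, N i j = ∑ l, Γ i j l * y l)
    (hk : ∀ l, k l = b l - s * Y l / α)
    (hFy : ∀ i, Fy i = Y i / α * (φ - s * φ2) + φ2 * b i)
    (hFyy : ∀ i l, Fyy i l
      = (a i l / α - Y i * Y l / α ^ 3) * (φ - s * φ2) + φ22 * k i * k l / α)
    (hFx : ∀ i, Fx i = ∑ j, N j i * Fy j + c * (2 * α * φ1 * b i + φ2 * Y i))
    (hdFx : ∀ i l, dFx i l = ∑ j, (Γ j i l * Fy j + N j i * Fyy j l)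
      + c * (2 * b i * (Y l / α * φ1 + φ12 * k l) + φ22 * k l / α * Y i + φ2 * a i l))
    (hP : 2 * (α * φ) * P = c * (2 * α * φ1 * (s * α) + φ2 * α ^ 2)
      - c * (α ^ 2 * κ) * (s * φ + φ2 * (t - s ^ 2)))
    (hG : ∀ i, G i = 1 / 2 * ∑ j, N i j * y j + 1 / 2 * c * (α ^ 2 * κ) * bu i + P * y i)
    (hpde : φ22 - 2 * (φ1 - s * φ12) = κ * (φ - s * φ2 + (t - s ^ 2) * φ22)) (l : Fin n) :
    ∑ i, (2 * Fy l * Fx i + 2 * (α * φ) * dFx i l) * y i - 2 * (α * φ) * Fx l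
      = 4 * ∑ i, (Fy l * Fy i + α * φ * Fyy i l) * G i := by
  have hky : ∑ i, k i * y i = 0 := by
    have : ∀ i, k i * y i = b i * y i - s / α * (Y i * y i) := fun i => by rw [hk]; ring
    simp only [this, Finset.sum_sub_distrib, ← Finset.mul_sum, hby, hYy]
    field_simp
    ring
  have hkb : ∑ i, k i * bu i = t - s ^ 2 := by
    have : ∀ i, k i * bu i = b i * bu i - s / α * (Y i * bu i) := fun i => by rw [hk]; ring
    simp only [this, Finset.sum_sub_distrib, ← Finset.mul_sum, hbb, hYb]
    field_simp
  have hFy_y : ∑ i, Fy i * y i = α * φ := by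
    have : ∀ i, Fy i * y i = (φ - s * φ2) / α * (Y i * y i) + φ2 * (b i * y i) := fun i => by
      rw [hFy]; ring
    simp only [this, Finset.sum_add_distrib, ← Finset.mul_sum, hby, hYy]
    field_simp
    ring
  have hFy_b : ∑ i, Fy i * bu i = s * φ + φ2 * (t - s ^ 2) := by
    have : ∀ i, Fy i * bu i = (φ - s * φ2) / α * (Y i * bu i) + φ2 * (b i * bu i) := fun i => by
      rw [hFy]; ring
    simp only [this, Finset.sum_add_distrib, ← Finset.mul_sum, hbb, hYb]
    field_simp
    ring
  have hFyy_v : ∀ v : Fin n → ℝ, ∑ i, Fyy i l * v i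
      = (φ - s * φ2) / α * (∑ i, a i l * v i) - (φ - s * φ2) * Y l / α ^ 3 * (∑ i, Y i * v i)
        + φ22 * k l / α * ∑ i, k i * v i := fun v => by
    simp only [Finset.mul_sum, ← Finset.sum_sub_distrib, ← Finset.sum_add_distrib]
    refine Finset.sum_congr rfl fun i _ => ?_
    rw [hFyy]
    ring
  have hFyy_y : ∑ i, Fyy i l * y i = 0 := by
    rw [hFyy_v, haY, hYy, hky]
    field_simp
    ring
  have hFyy_b : ∑ i, Fyy i l * bu i = k l / α * (φ - s * φ2 + (t - s ^ 2) * φ22) := by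
    rw [hFyy_v, hab, hYb, hkb, hk]
    field_simp
  have hS : ∑ i, Fx i * y i = ∑ j, (∑ i, N j i * y i) * Fy j
      + c * (2 * α * φ1 * (s * α) + φ2 * α ^ 2) := by
    have h1 : ∀ i, Fx i * y i = ∑ j, N j i * y i * Fy j
        + (c * (2 * α * φ1) * (b i * y i) + c * φ2 * (Y i * y i)) := fun i => by
      rw [hFx, add_mul, Finset.sum_mul]
      congr 1
      · exact Finset.sum_congr rfl fun j _ => by ring
      · ring
    simp only [h1, Finset.sum_add_distrib, ← Finset.mul_sum, hby, hYy]
    rw [Finset.sum_comm]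
    simp only [← Finset.sum_mul]
    ring
  have hdS : ∑ i, dFx i l * y i = ∑ j, N j l * Fy j + ∑ j, (∑ i, N j i * y i) * Fyy j l
      + c * (2 * (s * α) * (Y l / α * φ1 + φ12 * k l) + φ22 * k l / α * α ^ 2 + φ2 * Y l) := by
    have h1 : ∀ i, dFx i l * y i = ∑ j, Γ j l i * y i * Fy j + ∑ j, N j i * y i * Fyy j l
        + (c * 2 * (Y l / α * φ1 + φ12 * k l) * (b i * y i) + c * (φ22 * k l / α) * (Y i * y i)
          + c * φ2 * (a i l * y i)) := fun i => by
      rw [hdFx, add_mul, Finset.sum_mul, ← Finset.sum_add_distrib]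
      congr 1
      · exact Finset.sum_congr rfl fun j _ => by rw [hΓ j l i]; ring
      · ring
    simp only [h1, Finset.sum_add_distrib, ← Finset.mul_sum, hby, hYy, haY]
    rw [Finset.sum_comm, Finset.sum_comm (f := fun i j => N j i * y i * Fyy j l)]
    simp only [← Finset.sum_mul, ← hN]
    ring
  have hl : ∑ i, (2 * Fy l * Fx i + 2 * (α * φ) * dFx i l) * y i
      = 2 * Fy l * (∑ i, Fx i * y i) + 2 * (α * φ) * ∑ i, dFx i l * y i := by
    simp only [Finset.mul_sum, ← Finset.sum_add_distrib]
    exact Finset.sum_congr rfl fun i _ => by ring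
  have hr : ∑ i, (Fy l * Fy i + α * φ * Fyy i l) * G i
      = 1 / 2 * Fy l * (∑ j, (∑ i, N j i * y i) * Fy j)
        + 1 / 2 * (α * φ) * (∑ j, (∑ i, N j i * y i) * Fyy j l)
        + 1 / 2 * c * (α ^ 2 * κ)
          * (Fy l * (∑ i, Fy i * bu i) + α * φ * ∑ i, Fyy i l * bu i)
        + P * (Fy l * (∑ i, Fy i * y i) + α * φ * ∑ i, Fyy i l * y i) := by
    simp only [mul_add, Finset.mul_sum (a := P), Finset.mul_sum (a := α * φ),
      Finset.mul_sum (a := Fy l), Finset.mul_sum (a := 1 / 2 * Fy l),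
      Finset.mul_sum (a := 1 / 2 * (α * φ)),
      Finset.mul_sum (a := 1 / 2 * c * (α ^ 2 * κ)), ← Finset.sum_add_distrib]
    exact Finset.sum_congr rfl fun i _ => by rw [hG]; ring
  rw [hl, hr, hS, hdS, hFy_y, hFy_b, hFyy_y, hFyy_b, hFx]
  have hkl : Y l * s = α * (b l - k l) := by rw [hk]; field_simp; ring
  have hYα : α * (Y l / α) = Y l := by field_simp
  have hkα : α * (k l / α) = k l := by field_simp
  -- `hP` settles the coefficient of `F_l` and `hpde` that of `k_l`; the other terms only decompose
  -- `Y_l` and clear the division by `α`.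
  linear_combination (-2 * Fy l) * hP + 2 * (α * φ) * (c * α * k l) * hpde
    + (4 * α * φ * c * φ1) * hkl + 4 * α * φ * c * s * φ1 * hYα
    + 2 * α ^ 2 * φ * c * φ22 * hkα
    - 2 * c * α ^ 2 * κ * φ * (φ - s * φ2 + (t - s ^ 2) * φ22) * hkα

end Algebra

/-! ### Gradients in coordinate space -/

section Gradient

variable {n : ℕ}

/-- `u` is differentiable at `y`, with partial derivatives `u'`. -/
def HasGrad (u : Coord n → ℝ) (u' : Fin n → ℝ) (y : Coord n) : Prop :=
  DifferentiableAt ℝ u y ∧ ∀ l, pd l u y = u' l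

variable {u v : Coord n → ℝ} {u' v' : Fin n → ℝ} {y : Coord n}

theorem _root_.DifferentiableAt.hasGrad (h : DifferentiableAt ℝ u y) :
    HasGrad u (fun l => pd l u y) y :=
  ⟨h, fun _ => rfl⟩

theorem HasGrad.congr_grad (h : HasGrad u u' y) (e : ∀ l, u' l = v' l) : HasGrad u v' y :=
  ⟨h.1, fun l => (h.2 l).trans (e l)⟩

theorem HasGrad.congr_of_eventuallyEq (h : HasGrad u u' y) (e : v =ᶠ[𝓝 y] u) : HasGrad v u' y :=
  ⟨h.1.congr_of_eventuallyEq e, fun l => by rw [← h.2 l, pd, pd, e.fderiv_eq]⟩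

theorem hasGrad_const (r : ℝ) : HasGrad (fun _ : Coord n => r) 0 y :=
  ⟨differentiableAt_const r, fun l => by simp [pd]⟩

theorem hasGrad_coord (i : Fin n) :
    HasGrad (fun y : Coord n => y i) (fun l => if i = l then 1 else 0) y := by
  have h : HasFDerivAt (fun y : Coord n => y i) (EuclideanSpace.proj i : Coord n →L[ℝ] ℝ) y :=
    (EuclideanSpace.proj i : Coord n →L[ℝ] ℝ).hasFDerivAt
  refine ⟨h.differentiableAt, fun l => ?_⟩
  rw [pd, h.fderiv]
  simp

theorem HasGrad.add (hu : HasGrad u u' y) (hv : HasGrad v v' y) :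
    HasGrad (fun y => u y + v y) (fun l => u' l + v' l) y :=
  ⟨hu.1.add hv.1, fun l => by
    beta_reduce
    rw [← hu.2, ← hv.2, pd, fderiv_fun_add hu.1 hv.1]
    rfl⟩

theorem HasGrad.sub (hu : HasGrad u u' y) (hv : HasGrad v v' y) :
    HasGrad (fun y => u y - v y) (fun l => u' l - v' l) y :=
  ⟨hu.1.sub hv.1, fun l => by
    beta_reduce
    rw [← hu.2, ← hv.2, pd, fderiv_fun_sub hu.1 hv.1]
    rfl⟩

theorem HasGrad.mul (hu : HasGrad u u' y) (hv : HasGrad v v' y) :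
    HasGrad (fun y => u y * v y) (fun l => u' l * v y + u y * v' l) y := by
  refine ⟨hu.1.mul hv.1, fun l => ?_⟩
  beta_reduce
  rw [← hu.2, ← hv.2, pd, fderiv_fun_mul hu.1 hv.1]
  simp only [add_apply, smul_apply, smul_eq_mul, pd]
  ring

theorem HasGrad.const_mul (r : ℝ) (hu : HasGrad u u' y) :
    HasGrad (fun y => r * u y) (fun l => r * u' l) y :=
  ((hasGrad_const r).mul hu).congr_grad fun l => by simp

theorem HasGrad.mul_const (hu : HasGrad u u' y) (r : ℝ) :
    HasGrad (fun y => u y * r) (fun l => u' l * r) y :=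
  (hu.mul (hasGrad_const r)).congr_grad fun l => by simp

theorem HasGrad.sq (hu : HasGrad u u' y) :
    HasGrad (fun y => u y ^ 2) (fun l => 2 * u y * u' l) y := by
  simpa only [← pow_two] using (hu.mul hu).congr_grad fun l => by ring

theorem hasGrad_sum {ι : Type*} (s : Finset ι) {u : ι → Coord n → ℝ} {u' : ι → Fin n → ℝ}
    (h : ∀ i ∈ s, HasGrad (u i) (u' i) y) :
    HasGrad (fun y => ∑ i ∈ s, u i y) (fun l => ∑ i ∈ s, u' i l) y := by
  refine ⟨DifferentiableAt.fun_sum fun i hi => (h i hi).1, fun l => ?_⟩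
  rw [pd, fderiv_fun_sum fun i hi => (h i hi).1, sum_apply]
  exact Finset.sum_congr rfl fun i hi => (h i hi).2 l

theorem HasGrad.comp {ψ : ℝ → ℝ} {r : ℝ} (hψ : HasDerivAt ψ r (u y)) (hu : HasGrad u u' y) :
    HasGrad (fun y => ψ (u y)) (fun l => r * u' l) y := by
  have h := hψ.comp_hasFDerivAt y hu.1.hasFDerivAt
  refine ⟨h.differentiableAt, fun l => ?_⟩
  beta_reduce
  rw [← hu.2, pd]
  change fderiv ℝ (ψ ∘ u) y _ = _
  rw [h.fderiv]
  rfl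

theorem HasGrad.comp₂ {ψ : ℝ → ℝ → ℝ} (hψ : DifferentiableAt ℝ (uncurry ψ) (u y, v y))
    (hu : HasGrad u u' y) (hv : HasGrad v v' y) :
    HasGrad (fun y => ψ (u y) (v y))
      (fun l => D1 ψ (u y) (v y) * u' l + D2 ψ (u y) (v y) * v' l) y := by
  have h := hψ.hasFDerivAt.comp y (hu.1.hasFDerivAt.prodMk hv.1.hasFDerivAt)
  refine ⟨h.differentiableAt, fun l => ?_⟩
  have e1 := D1_eq_fderiv hψ
  have e2 := D2_eq_fderiv hψ
  simp only at e1 e2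
  beta_reduce
  rw [← hu.2, ← hv.2, pd, e1, e2]
  change fderiv ℝ (uncurry ψ ∘ fun y => (u y, v y)) y _ = _
  rw [h.fderiv]
  have hsplit : ∀ (L : ℝ × ℝ →L[ℝ] ℝ) (r s : ℝ), L (r, s) = L (1, 0) * r + L (0, 1) * s := by
    intro L r s
    rw [mul_comm, mul_comm (L (0, 1)), ← smul_eq_mul, ← smul_eq_mul, ← map_smul, ← map_smul,
      ← map_add]
    simp
  exact hsplit _ _ _

theorem HasGrad.sqrt (hu : HasGrad u u' y) (h0 : 0 < u y) :
    HasGrad (fun y => √(u y)) (fun l => u' l / (2 * √(u y))) y :=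
  (hu.comp (Real.hasDerivAt_sqrt h0.ne')).congr_grad fun l => by ring

theorem HasGrad.div (hu : HasGrad u u' y) (hv : HasGrad v v' y) (h0 : v y ≠ 0) :
    HasGrad (fun y => u y / v y) (fun l => u' l / v y - u y * v' l / v y ^ 2) y := by
  have := hu.mul (hv.comp (hasDerivAt_inv h0))
  simp only [← div_eq_mul_inv] at this
  exact this.congr_grad fun l => by ring

/-- Differentiate `r ↦ u (r y)` at `r = 1`. Scaling near `1` suffices, so the lemma applies to
positively homogeneous functions. -/
theorem HasGrad.euler (hu : HasGrad u u' y) (hh : ∀ᶠ r : ℝ in 𝓝 1, u (r • y) = r * u y) :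
    ∑ l, u' l * y l = u y := by
  have h1 : HasDerivAt (fun r : ℝ => r • y) y 1 := by
    simpa using (hasDerivAt_id (1 : ℝ)).smul_const y
  have h2 : HasDerivAt (fun r : ℝ => u (r • y)) (fderiv ℝ u y y) 1 := by
    have h3 : HasFDerivAt u (fderiv ℝ u y) ((1 : ℝ) • y) := by
      simpa using hu.1.hasFDerivAt
    exact HasFDerivAt.comp_hasDerivAt (f := fun r : ℝ => r • y) 1 h3 h1
  have h4 : HasDerivAt (fun r : ℝ => r * u y) (u y) 1 := by
    simpa using (hasDerivAt_id (1 : ℝ)).mul_const (u y)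
  rw [h4.unique (h2.congr_of_eventuallyEq (hh.mono fun r hr => hr.symm))]
  have hy : y = ∑ l, y l • EuclideanSpace.single l (1 : ℝ) := by
    ext i
    simp [Finset.sum_apply, Pi.single_apply]
  conv_rhs => rw [hy]
  rw [map_sum]
  refine Finset.sum_congr rfl fun l _ => ?_
  rw [map_smul, smul_eq_mul, ← hu.2, pd, ← hy, mul_comm]

end Gradient

/-! ### Expressions in a chart -/

section Expressions

variable {n : ℕ}

/-- The quadratic form of a matrix. -/
noncomputable def quad (m : Matrix (Fin n) (Fin n) ℝ) (y : Fin n → ℝ) : ℝ :=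
  ∑ i, (∑ j, m i j * y j) * y i

/-- The value of the `1`-form with components `w`. -/
noncomputable def formVal (w : Fin n → ℝ) (y : Fin n → ℝ) : ℝ := ∑ i, w i * y i

/-- The components `b^i` of the vector dual to a `1`-form. -/
noncomputable def sharp (m : Matrix (Fin n) (Fin n) ℝ) (w : Fin n → ℝ) (i : Fin n) : ℝ :=
  ∑ j, m⁻¹ i j * w j

/-- The squared length of a `1`-form. -/
noncomputable def dualQuad (m : Matrix (Fin n) (Fin n) ℝ) (w : Fin n → ℝ) : ℝ :=
  formVal w (sharp m w)

/-- The ratio `s = β / α`. -/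
noncomputable def slope (m : Matrix (Fin n) (Fin n) ℝ) (w : Fin n → ℝ) (y : Fin n → ℝ) : ℝ :=
  formVal w y / √(quad m y)

/-- The function `α φ(t, β / α)`. -/
noncomputable def abNorm (φ : ℝ → ℝ → ℝ) (m : Matrix (Fin n) (Fin n) ℝ) (w : Fin n → ℝ) (t : ℝ)
    (y : Fin n → ℝ) : ℝ :=
  √(quad m y) * φ t (slope m w y)

/-- The partial derivatives of `α φ(t, β / α)` with respect to `y`. -/
noncomputable def abGrad (φ : ℝ → ℝ → ℝ) (m : Matrix (Fin n) (Fin n) ℝ) (w : Fin n → ℝ) (t : ℝ)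
    (y : Fin n → ℝ) (i : Fin n) : ℝ :=
  (∑ j, m i j * y j) / √(quad m y)
      * (φ t (slope m w y) - slope m w y * D2 φ t (slope m w y))
    + D2 φ t (slope m w y) * w i

/-- The components of `b_i - s y_i / α`. -/
noncomputable def transverse (m : Matrix (Fin n) (Fin n) ℝ) (w : Fin n → ℝ) (y : Fin n → ℝ)
    (l : Fin n) : ℝ :=
  w l - slope m w y * (∑ j, m l j * y j) / √(quad m y)

variable {m : Matrix (Fin n) (Fin n) ℝ} {w : Fin n → ℝ} {t : ℝ} {y : Coord n}

theorem hasGrad_linear (r : Fin n → ℝ) :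
    HasGrad (fun y : Coord n => ∑ j, r j * y j) r y :=
  (hasGrad_sum Finset.univ fun j _ => (hasGrad_coord j).const_mul (r j)).congr_grad
    fun l => by simp

theorem hasGrad_quad (hm : m.IsSymm) :
    HasGrad (fun y : Coord n => quad m y) (fun l => 2 * ∑ j, m l j * y j) y := by
  refine (hasGrad_sum Finset.univ fun i _ =>
    (hasGrad_linear (m i)).mul (hasGrad_coord i)).congr_grad fun l => ?_
  simp only [Finset.sum_add_distrib, mul_ite, mul_one, mul_zero, Finset.sum_ite_eq',
    Finset.mem_univ, if_true, two_mul]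
  congr 1
  exact Finset.sum_congr rfl fun i _ => by rw [hm.apply]

theorem hasGrad_slope (hm : m.IsSymm) (hy : 0 < quad m y) :
    HasGrad (fun y : Coord n => slope m w y)
      (fun l => transverse m w y l / √(quad m y)) y := by
  have hr : 0 < √(quad m y) := Real.sqrt_pos.2 hy
  refine ((hasGrad_linear w).div ((hasGrad_quad hm).sqrt hy) hr.ne').congr_grad fun l => ?_
  simp only [transverse, slope, formVal]
  field_simp

theorem hasGrad_comp_slope {ψ : ℝ → ℝ → ℝ} (hm : m.IsSymm) (hy : 0 < quad m y)
    (hψ : DifferentiableAt ℝ (uncurry ψ) (t, slope m w y)) :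
    HasGrad (fun y : Coord n => ψ t (slope m w y))
      (fun l => D2 ψ t (slope m w y) * (transverse m w y l / √(quad m y))) y :=
  (hasGrad_slope hm hy).comp (hasDerivAt_D2 hψ)

theorem hasGrad_abNorm {φ : ℝ → ℝ → ℝ} (hm : m.IsSymm) (hy : 0 < quad m y)
    (hφ : DifferentiableAt ℝ (uncurry φ) (t, slope m w y)) :
    HasGrad (fun y : Coord n => abNorm φ m w t y) (abGrad φ m w t y) y := by
  have hr : 0 < √(quad m y) := Real.sqrt_pos.2 hy
  refine (((hasGrad_quad hm).sqrt hy).mul (hasGrad_comp_slope hm hy hφ)).congr_grad fun l => ?_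
  simp only [abGrad, transverse]
  field_simp
  ring

theorem hasGrad_abGrad {φ : ℝ → ℝ → ℝ} (hm : m.IsSymm) (hy : 0 < quad m y)
    (hφ : DifferentiableAt ℝ (uncurry φ) (t, slope m w y))
    (hφ2 : DifferentiableAt ℝ (uncurry (D2 φ)) (t, slope m w y)) (i : Fin n) :
    HasGrad (fun y : Coord n => abGrad φ m w t y i)
      (fun l => (m i l / √(quad m y)
          - (∑ j, m i j * y j) * (∑ j, m l j * y j) / √(quad m y) ^ 3)
          * (φ t (slope m w y) - slope m w y * D2 φ t (slope m w y))
        + D2 (D2 φ) t (slope m w y) * transverse m w y i * transverse m w y l / √(quad m y)) y := by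
  have hr : 0 < √(quad m y) := Real.sqrt_pos.2 hy
  have h2 := hasGrad_comp_slope hm hy hφ2
  refine ((((hasGrad_linear (m i)).div ((hasGrad_quad hm).sqrt hy) hr.ne').mul
    ((hasGrad_comp_slope hm hy hφ).sub ((hasGrad_slope hm hy).mul h2))).add
      (h2.mul_const (w i))).congr_grad fun l => ?_
  simp only [transverse]
  field_simp
  ring

end Expressions

/-! ### Christoffel symbols -/

section Christoffel

variable {n : ℕ}

/-- Components, in a chart with image `S`, of a Riemannian metric and a `1`-form with
`b_{i|j} = c a_{ij}`. -/
structure IsConformalChart (S : Set (Coord n)) (a : Coord n → Matrix (Fin n) (Fin n) ℝ)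
    (b : Fin n → Coord n → ℝ) (c : Coord n → ℝ) : Prop where
  isOpen : IsOpen S
  smooth_metric : ∀ i j, ContDiffOn ℝ ∞ (fun x => a x i j) S
  smooth_form : ∀ i, ContDiffOn ℝ ∞ (b i) S
  posDef : ∀ x ∈ S, (a x).PosDef
  covDeriv_eq : ∀ x ∈ S, ∀ i j, covDeriv a b i j x = c x * a x i j

variable {S : Set (Coord n)} {a : Coord n → Matrix (Fin n) (Fin n) ℝ} {b : Fin n → Coord n → ℝ}
  {c : Coord n → ℝ} {x : Coord n}

theorem contDiffOn_det {E : Type*} [NormedAddCommGroup E] [NormedSpace ℝ E] {T : Set E}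
    {m : E → Matrix (Fin n) (Fin n) ℝ} (hm : ∀ i j, ContDiffOn ℝ ∞ (fun x => m x i j) T) :
    ContDiffOn ℝ ∞ (fun x => (m x).det) T := by
  simp only [Matrix.det_apply']
  exact ContDiffOn.sum fun σ _ => contDiffOn_const.mul (contDiffOn_prod fun i _ => hm _ _)

theorem contDiffOn_inv_apply {E : Type*} [NormedAddCommGroup E] [NormedSpace ℝ E] {T : Set E}
    {m : E → Matrix (Fin n) (Fin n) ℝ} (hm : ∀ i j, ContDiffOn ℝ ∞ (fun x => m x i j) T)
    (h0 : ∀ x ∈ T, (m x).det ≠ 0) (i j : Fin n) : ContDiffOn ℝ ∞ (fun x => (m x)⁻¹ i j) T := by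
  simp only [Matrix.inv_def, Matrix.smul_apply, Ring.inverse_eq_inv', smul_eq_mul,
    Matrix.adjugate_apply]
  refine ((contDiffOn_det hm).inv h0).mul (contDiffOn_det fun k l => ?_)
  simp only [Matrix.updateRow_apply]
  split_ifs
  · exact contDiffOn_const
  · exact hm k l

theorem IsConformalChart.isSymm (h : IsConformalChart S a b c) (hx : x ∈ S) : (a x).IsSymm :=
  (Matrix.isHermitian_iff_isSymm).1 (h.posDef x hx).isHermitian

theorem IsConformalChart.det_ne_zero (h : IsConformalChart S a b c) (hx : x ∈ S) :
    (a x).det ≠ 0 :=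
  (h.posDef x hx).det_pos.ne'

theorem IsConformalChart.pd_symm (h : IsConformalChart S a b c) (hx : x ∈ S) (l i j : Fin n) :
    pd l (fun x' => a x' i j) x = pd l (fun x' => a x' j i) x := by
  have e : (fun x' => a x' i j) =ᶠ[𝓝 x] fun x' => a x' j i := by
    filter_upwards [h.isOpen.mem_nhds hx] with z hz using (h.isSymm hz).apply j i
  rw [pd, pd, e.fderiv_eq]

theorem IsConformalChart.christoffel_symm (h : IsConformalChart S a b c) (hx : x ∈ S)
    (k i j : Fin n) : christoffel a k i j x = christoffel a k j i x := by
  unfold christoffel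
  congr 1
  refine Finset.sum_congr rfl fun l _ => ?_
  rw [h.pd_symm hx l i j]
  ring

theorem IsConformalChart.sum_mul_christoffel (h : IsConformalChart S a b c) (hx : x ∈ S)
    (l i j : Fin n) : ∑ k, a x l k * christoffel a k i j x
      = 1 / 2 * (pd i (fun x' => a x' l j) x + pd j (fun x' => a x' l i) x
        - pd l (fun x' => a x' i j) x) := by
  have hinv : a x * (a x)⁻¹ = 1 := Matrix.mul_nonsing_inv _ (h.det_ne_zero hx).isUnit
  have h1 : ∀ q, ∑ k, a x l k * (a x)⁻¹ k q = if l = q then 1 else 0 := fun q => by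
    rw [← Matrix.mul_apply, hinv, Matrix.one_apply]
  simp only [christoffel, Finset.mul_sum]
  rw [Finset.sum_comm]
  have h2 : ∀ q, ∑ k, a x l k * (1 / 2 * ((a x)⁻¹ k q * (pd i (fun x' => a x' q j) x
      + pd j (fun x' => a x' q i) x - pd q (fun x' => a x' i j) x)))
      = (if l = q then 1 else 0) * (1 / 2 * (pd i (fun x' => a x' q j) x
      + pd j (fun x' => a x' q i) x - pd q (fun x' => a x' i j) x)) := fun q => by
    rw [← h1 q, Finset.sum_mul]
    exact Finset.sum_congr rfl fun k _ => by ring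
  simp only [h2, ite_mul, one_mul, zero_mul, Finset.sum_ite_eq, Finset.mem_univ, if_true]

/-- Compatibility of the connection with the metric, contracted twice with `v`: of the three terms
in the lowered Christoffel symbol, two are exchanged by the symmetry of `v^j v^l` and cancel. -/
theorem IsConformalChart.pd_quad (h : IsConformalChart S a b c) (hx : x ∈ S) (k : Fin n)
    (v : Fin n → ℝ) : ∑ i, (∑ j, pd k (fun x' => a x' i j) x * v j) * v i
      = 2 * ∑ i, (∑ j, christoffel a i k j x * v j) * ∑ l, a x i l * v l := by
  have h1 : ∑ i, (∑ j, christoffel a i k j x * v j) * ∑ l, a x i l * v l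
      = ∑ l, ∑ j, (∑ i, a x l i * christoffel a i k j x) * (v j * v l) := by
    simp only [Finset.mul_sum]
    rw [Finset.sum_comm]
    refine Finset.sum_congr rfl fun l _ => ?_
    simp only [Finset.sum_mul]
    rw [Finset.sum_comm]
    refine Finset.sum_congr rfl fun j _ => Finset.sum_congr rfl fun i _ => ?_
    rw [(h.isSymm hx).apply l i]
    ring
  have h2 : ∑ l, ∑ j, pd j (fun x' => a x' l k) x * (v j * v l)
      = ∑ l, ∑ j, pd l (fun x' => a x' k j) x * (v j * v l) := by
    rw [Finset.sum_comm]
    refine Finset.sum_congr rfl fun l _ => Finset.sum_congr rfl fun j _ => ?_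
    rw [h.pd_symm hx l j k]
    ring
  simp only [h.sum_mul_christoffel hx] at h1
  rw [h1]
  have h3 : ∑ l, ∑ j, 1 / 2 * (pd k (fun x' => a x' l j) x + pd j (fun x' => a x' l k) x
      - pd l (fun x' => a x' k j) x) * (v j * v l)
      = 1 / 2 * (∑ l, ∑ j, pd k (fun x' => a x' l j) x * (v j * v l)
        + ∑ l, ∑ j, pd j (fun x' => a x' l k) x * (v j * v l)
        - ∑ l, ∑ j, pd l (fun x' => a x' k j) x * (v j * v l)) := by
    simp only [← Finset.sum_add_distrib, ← Finset.sum_sub_distrib, Finset.mul_sum]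
    exact Finset.sum_congr rfl fun l _ => Finset.sum_congr rfl fun j _ => by ring
  rw [h3, h2, add_sub_cancel_right]
  simp only [Finset.sum_mul, Finset.mul_sum]
  exact Finset.sum_congr rfl fun l _ => Finset.sum_congr rfl fun j _ => by ring

theorem sum_mul_sharp {m : Matrix (Fin n) (Fin n) ℝ} (hm : m.det ≠ 0) (w : Fin n → ℝ) (l : Fin n) :
    ∑ i, m l i * sharp m w i = w l := by
  have : m.mulVec (m⁻¹.mulVec w) = w := by
    rw [Matrix.mulVec_mulVec, Matrix.mul_nonsing_inv _ hm.isUnit, Matrix.one_mulVec]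
  exact congrFun this l

theorem IsConformalChart.pd_form (h : IsConformalChart S a b c) (hx : x ∈ S) (i k : Fin n) :
    pd k (b i) x = c x * a x i k + ∑ l, christoffel a l i k x * b l x := by
  rw [← h.covDeriv_eq x hx, covDeriv]
  ring

theorem IsConformalChart.sum_pd_form (h : IsConformalChart S a b c) (hx : x ∈ S) (k : Fin n)
    (v : Fin n → ℝ) : ∑ i, pd k (b i) x * v i
      = c x * (∑ i, a x k i * v i) + ∑ i, (∑ j, christoffel a i k j x * v j) * b i x := by
  simp only [h.pd_form hx, add_mul, Finset.sum_add_distrib, Finset.mul_sum, Finset.sum_mul]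
  congr 1
  · exact Finset.sum_congr rfl fun i _ => by rw [(h.isSymm hx).apply k i]; ring
  · rw [Finset.sum_comm]
    refine Finset.sum_congr rfl fun l _ => Finset.sum_congr rfl fun i _ => ?_
    rw [h.christoffel_symm hx l i k]
    ring

theorem IsConformalChart.differentiableAt_metric (h : IsConformalChart S a b c) (hx : x ∈ S)
    (i j : Fin n) : DifferentiableAt ℝ (fun x => a x i j) x :=
  ((h.smooth_metric i j).contDiffAt (h.isOpen.mem_nhds hx)).differentiableAt (by simp)

theorem IsConformalChart.differentiableAt_form (h : IsConformalChart S a b c) (hx : x ∈ S)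
    (i : Fin n) : DifferentiableAt ℝ (b i) x :=
  ((h.smooth_form i).contDiffAt (h.isOpen.mem_nhds hx)).differentiableAt (by simp)

theorem IsConformalChart.hasGrad_metric_quad (h : IsConformalChart S a b c) (hx : x ∈ S)
    (v : Fin n → ℝ) : HasGrad (fun x => quad (a x) v)
      (fun k => 2 * ∑ i, (∑ j, christoffel a i k j x * v j) * ∑ l, a x i l * v l) x := by
  refine HasGrad.congr_grad (hasGrad_sum Finset.univ fun i _ => (hasGrad_sum Finset.univ fun j _ =>
    (h.differentiableAt_metric hx i j).hasGrad.mul_const (v j)).mul_const (v i)) fun k => ?_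
  exact h.pd_quad hx k v

theorem IsConformalChart.hasGrad_formVal (h : IsConformalChart S a b c) (hx : x ∈ S)
    (v : Fin n → ℝ) : HasGrad (fun x => formVal (fun i => b i x) v)
      (fun k => c x * (∑ i, a x k i * v i)
        + ∑ i, (∑ j, christoffel a i k j x * v j) * b i x) x := by
  refine HasGrad.congr_grad (hasGrad_sum Finset.univ fun i _ =>
    (h.differentiableAt_form hx i).hasGrad.mul_const (v i)) fun k => ?_
  exact h.sum_pd_form hx k v

/-- Write `b² = 2 b_i B^i - a_{ij} B^i B^j` with `B` the raised form. This expression is stationary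
in `B`, so the derivatives of `B`, and with them those of the inverse matrix, cancel. The
Christoffel terms of the two summands cancel as well and only `2 c b_k` is left. -/
theorem IsConformalChart.hasGrad_dualQuad (h : IsConformalChart S a b c) (hx : x ∈ S) :
    HasGrad (fun x => dualQuad (a x) fun i => b i x) (fun k => 2 * c x * b k x) x := by
  set B : Coord n → Fin n → ℝ := fun x => sharp (a x) fun i => b i x with hB
  have hBd : ∀ i, HasGrad (fun x => B x i) (fun k => pd k (fun x => B x i) x) x := fun i => by
    refine DifferentiableAt.hasGrad (DifferentiableAt.fun_sum fun j _ =>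
      DifferentiableAt.mul ?_ (h.differentiableAt_form hx j))
    exact ((contDiffOn_inv_apply h.smooth_metric (fun z hz => h.det_ne_zero hz) i j).contDiffAt
      (h.isOpen.mem_nhds hx)).differentiableAt (by simp)
  have h1 : HasGrad (fun z => ∑ i, b i z * B z i)
      (fun k => ∑ i, (pd k (b i) x * B x i + b i x * pd k (fun x => B x i) x)) x :=
    hasGrad_sum Finset.univ fun i _ => (h.differentiableAt_form hx i).hasGrad.mul (hBd i)
  have h2 : HasGrad (fun z => ∑ i, (∑ j, a z i j * B z j) * B z i) (fun k => ∑ i,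
      ((∑ j, (pd k (fun x' => a x' i j) x * B x j + a x i j * pd k (fun x => B x j) x)) * B x i
        + (∑ j, a x i j * B x j) * pd k (fun x => B x i) x)) x :=
    hasGrad_sum Finset.univ fun i _ => (hasGrad_sum Finset.univ fun j _ =>
      (h.differentiableAt_metric hx i j).hasGrad.mul (hBd j)).mul (hBd i)
  have hlow : ∀ z ∈ S, ∀ i, ∑ j, a z i j * B z j = b i z := fun z hz i =>
    sum_mul_sharp (h.det_ne_zero hz) _ i
  refine HasGrad.congr_of_eventuallyEq (((h1.const_mul 2).sub h2).congr_grad fun k => ?_) ?_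
  · have e1 : ∑ i, (∑ j, a x i j * pd k (fun x => B x j) x) * B x i
        = ∑ i, b i x * pd k (fun x => B x i) x := by
      simp only [Finset.sum_mul]
      rw [Finset.sum_comm]
      refine Finset.sum_congr rfl fun j _ => ?_
      rw [← hlow x hx j, Finset.sum_mul]
      exact Finset.sum_congr rfl fun i _ => by rw [(h.isSymm hx).apply j i]; ring
    have e2 := h.pd_quad hx k (B x)
    have e3 := h.sum_pd_form hx k (B x)
    simp only [hlow x hx] at e2 e3 ⊢
    simp only [Finset.sum_add_distrib, add_mul, e1, e2, e3]
    ring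
  · filter_upwards [h.isOpen.mem_nhds hx] with z hz
    simp only [hlow z hz]
    change ∑ i, b i z * B z i = _
    ring

end Christoffel

/-! ### Projective changes of quadratic sprays -/

section Projective

variable {n : ℕ}

theorem hasGrad_quad_of_matrix (m : Matrix (Fin n) (Fin n) ℝ) (y : Coord n) :
    HasGrad (fun y : Coord n => quad m y) (fun l => ∑ j, (m l j + m j l) * y j) y := by
  refine (hasGrad_sum Finset.univ fun i _ =>
    (hasGrad_linear (m i)).mul (hasGrad_coord i)).congr_grad fun l => ?_
  simp only [Finset.sum_add_distrib, mul_ite, mul_one, mul_zero, Finset.sum_ite_eq',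
    Finset.mem_univ, if_true, add_mul]
  exact add_comm _ _

theorem _root_.Filter.EventuallyEq.pd {u v : Coord n → ℝ} {y : Coord n} (h : u =ᶠ[𝓝 y] v)
    (l : Fin n) : pd l u =ᶠ[𝓝 y] pd l v := by
  filter_upwards [h.fderiv (𝕜 := ℝ)] with z hz
  rw [GenAB.pd, GenAB.pd, hz]

theorem pd_pd_pd_eq_zero {u : Coord n → ℝ} {m : Matrix (Fin n) (Fin n) ℝ} {y : Coord n}
    (h : u =ᶠ[𝓝 y] fun y => quad m y) (j k l : Fin n) : pd j (pd k (pd l u)) y = 0 := by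
  have h1 : pd l (fun y : Coord n => quad m y) = fun y => ∑ j, (m l j + m j l) * y j :=
    funext fun z => (hasGrad_quad_of_matrix m z).2 l
  have h2 : pd k (fun y : Coord n => ∑ j, (m l j + m j l) * y j) = fun _ => m l k + m k l :=
    funext fun z => (hasGrad_linear _).2 k
  rw [(((h.pd l).pd k).pd j).self_of_nhds, h1, h2]
  simp [pd]

/-- If `G^i` differs from a quadratic form by `P y^i`, with `P` positively homogeneous of degree
one, then its Douglas tensor vanishes. -/
theorem douglas_eq_zero_of_projective {G : Fin n → Coord n → ℝ} {T : Set (Coord n)}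
    (hT : IsOpen T) (K : Fin n → Matrix (Fin n) (Fin n) ℝ) (P : Coord n → ℝ)
    (hP : ∀ y ∈ T, DifferentiableAt ℝ P y)
    (hhom : ∀ y ∈ T, ∀ᶠ r : ℝ in 𝓝 1, P (r • y) = r * P y)
    (hG : ∀ y ∈ T, ∀ i, G i y = quad (K i) y + P y * y i) {y : Coord n} (hy : y ∈ T)
    (i j k l : Fin n) :
    pd j (pd k (pd l (fun y' => G i y'
      - (1 / ((n : ℝ) + 1)) * (∑ m, pd m (fun y'' => G m y'') y') * y' i))) y = 0 := by
  -- By Euler's relation the divergence of `P y^i` is `(n + 1) P`, so the correction term removes `P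
  -- y^i`; the rest of the divergence is linear in `y`.
  have hdiv : ∀ z ∈ T, ∑ m, pd m (fun y'' => G m y'') z
      = (∑ q, (∑ m, (K m m q + K m q m)) * z q) + ((n : ℝ) + 1) * P z := by
    intro z hz
    have hPz := (hP z hz).hasGrad
    have h1 : ∀ m, pd m (fun y'' => G m y'') z
        = ∑ q, (K m m q + K m q m) * z q + (pd m P z * z m + P z) := fun m => by
      have h2 : (fun y'' => G m y'') =ᶠ[𝓝 z] fun y => quad (K m) y + P y * y m := by
        filter_upwards [hT.mem_nhds hz] with z' hz' using hG z' hz' m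
      rw [(((hasGrad_quad_of_matrix (K m) z).add
        (hPz.mul (hasGrad_coord m))).congr_of_eventuallyEq h2).2]
      simp
    simp only [h1, Finset.sum_add_distrib, hPz.euler (hhom z hz), Finset.sum_const,
      Finset.card_univ, Fintype.card_fin, nsmul_eq_mul]
    rw [Finset.sum_comm]
    simp only [← Finset.sum_mul, ← Finset.sum_add_distrib]
    ring
  let r : Fin n → ℝ := fun q => ∑ m, (K m m q + K m q m)
  -- The subtracted matrix has only its `i`-th row nonzero; its quadratic form is the linear part of
  -- the divergence times `y^i / (n + 1)`.
  refine pd_pd_pd_eq_zero (m := K i - Matrix.of fun p q =>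
    if p = i then 1 / ((n : ℝ) + 1) * r q else 0) ?_ j k l
  filter_upwards [hT.mem_nhds hy] with z hz
  have hn : (n : ℝ) + 1 ≠ 0 := by positivity
  have hq : quad (K i - Matrix.of fun p q => if p = i then 1 / ((n : ℝ) + 1) * r q else 0) z
      = quad (K i) z - 1 / ((n : ℝ) + 1) * (∑ q, r q * z q) * z i := by
    simp only [quad, Matrix.sub_apply, Matrix.of_apply, sub_mul, Finset.sum_sub_distrib, ite_mul,
      zero_mul]
    congr 1
    rw [Finset.sum_eq_single i (fun p _ hp => by simp [hp]) (fun h => absurd (Finset.mem_univ i) h)]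
    simp only [if_true, Finset.mul_sum, mul_assoc]
  rw [hdiv z hz, hG z hz, hq]
  field_simp
  ring

end Projective

/-! ### The geodesic coefficients of a general `(α, β)`-metric -/

section Spray

variable {n : ℕ} {b₀ : EReal} {f g : ℝ → ℝ} {φ : ℝ → ℝ → ℝ} {S : Set (Coord n)}
  {a : Coord n → Matrix (Fin n) (Fin n) ℝ} {b : Fin n → Coord n → ℝ} {c : Coord n → ℝ}
  {x y : Coord n} {m : Matrix (Fin n) (Fin n) ℝ} {w : Fin n → ℝ} {t : ℝ}

theorem slope_mem_openDomain {y : Fin n → ℝ} (hy : 0 < quad m y)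
    (hs : formVal w y ^ 2 < t * quad m y) (ht : ((√t : ℝ) : EReal) < b₀) :
    (t, slope m w y) ∈ openDomain b₀ := by
  refine ⟨?_, ht⟩
  change (formVal w y / √(quad m y)) ^ 2 < t
  rwa [div_pow, Real.sq_sqrt hy.le, div_lt_iff₀ hy]

theorem quad_smul (r : ℝ) (y : Coord n) : quad m (r • y : Coord n) = r ^ 2 * quad m y := by
  simp only [quad, Finset.mul_sum, Finset.sum_mul, PiLp.smul_apply, smul_eq_mul]
  exact Finset.sum_congr rfl fun i _ => Finset.sum_congr rfl fun j _ => by ring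

theorem formVal_smul (r : ℝ) (y : Coord n) : formVal w (r • y : Coord n) = r * formVal w y := by
  simp only [formVal, Finset.mul_sum, PiLp.smul_apply, smul_eq_mul]
  exact Finset.sum_congr rfl fun i _ => by ring

theorem sqrt_quad_smul {r : ℝ} (hr : 0 < r) (y : Coord n) :
    √(quad m (r • y : Coord n)) = r * √(quad m y) := by
  rw [quad_smul, Real.sqrt_mul (sq_nonneg r), Real.sqrt_sq hr.le]

theorem slope_smul {r : ℝ} (hr : 0 < r) (y : Coord n) :
    slope m w (r • y : Coord n) = slope m w y := by
  rw [slope, formVal_smul, sqrt_quad_smul hr, slope, mul_div_mul_left _ _ hr.ne']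

/-- The partial derivatives of `α φ(b², β / α)` with respect to `x`, where `b_{i|j} = c a_{ij}`. -/
noncomputable def abGradBase (φ : ℝ → ℝ → ℝ) (Γ : Fin n → Fin n → Fin n → ℝ)
    (m : Matrix (Fin n) (Fin n) ℝ) (w : Fin n → ℝ) (t c : ℝ) (y : Fin n → ℝ) (k : Fin n) : ℝ :=
  ∑ i, (∑ j, Γ i k j * y j) * abGrad φ m w t y i
    + c * (2 * √(quad m y) * D1 φ t (slope m w y) * w k
      + D2 φ t (slope m w y) * ∑ j, m k j * y j)

/-- The Christoffel parts of the derivatives of `α` and `β` combine into `Γ^i_{kj} y^j F_{y^i}`. The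
terms with `c` come from `d(b²) = 2cβ` and from the covariant derivative of `β`. -/
theorem IsConformalChart.hasGrad_abNorm_base (h : IsConformalChart S a b c) (hx : x ∈ S)
    (hy : 0 < quad (a x) y)
    (hφ : DifferentiableAt ℝ (uncurry φ)
      (dualQuad (a x) (fun i => b i x), slope (a x) (fun i => b i x) y)) :
    HasGrad (fun x => abNorm φ (a x) (fun i => b i x) (dualQuad (a x) fun i => b i x) y)
      (abGradBase φ (fun i j k => christoffel a i j k x) (a x) (fun i => b i x)
        (dualQuad (a x) fun i => b i x) (c x) y) x := by
  have hr : 0 < √(quad (a x) y) := Real.sqrt_pos.2 hy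
  have h1 := (h.hasGrad_metric_quad hx y).sqrt hy
  have h2 : HasGrad (fun x => slope (a x) (fun i => b i x) y) _ x :=
    (h.hasGrad_formVal hx y).div h1 hr.ne'
  refine (h1.mul ((h.hasGrad_dualQuad hx).comp₂ hφ h2)).congr_grad fun k => ?_
  simp only [abGradBase]
  have hG : ∑ i, (∑ j, christoffel a i k j x * y j) * abGrad φ (a x) (fun i => b i x)
        (dualQuad (a x) fun i => b i x) y i
      = (φ (dualQuad (a x) fun i => b i x) (slope (a x) (fun i => b i x) y)
          - slope (a x) (fun i => b i x) y
            * D2 φ (dualQuad (a x) fun i => b i x) (slope (a x) (fun i => b i x) y))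
          / √(quad (a x) y)
          * (∑ i, (∑ j, christoffel a i k j x * y j) * ∑ l, a x i l * y l)
        + D2 φ (dualQuad (a x) fun i => b i x) (slope (a x) (fun i => b i x) y)
          * ∑ i, (∑ j, christoffel a i k j x * y j) * b i x := by
    rw [Finset.mul_sum, Finset.mul_sum, ← Finset.sum_add_distrib]
    refine Finset.sum_congr rfl fun i _ => ?_
    rw [abGrad]
    ring
  rw [hG]
  have hs : formVal (fun i => b i x) y = slope (a x) (fun i => b i x) y * √(quad (a x) y) := by
    rw [slope, div_mul_cancel₀ _ hr.ne']
  rw [hs]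
  field_simp
  ring

theorem hasGrad_abGradBase {Γ : Fin n → Fin n → Fin n → ℝ} {c : ℝ} (hm : m.IsSymm)
    (hy : 0 < quad m y) (hφ : DifferentiableAt ℝ (uncurry φ) (t, slope m w y))
    (hφ1 : DifferentiableAt ℝ (uncurry (D1 φ)) (t, slope m w y))
    (hφ2 : DifferentiableAt ℝ (uncurry (D2 φ)) (t, slope m w y)) (k : Fin n) :
    HasGrad (fun y : Coord n => abGradBase φ Γ m w t c y k)
      (fun l => ∑ i, (Γ i k l * abGrad φ m w t y i + (∑ j, Γ i k j * y j)
          * ((m i l / √(quad m y)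
            - (∑ j, m i j * y j) * (∑ j, m l j * y j) / √(quad m y) ^ 3)
          * (φ t (slope m w y) - slope m w y * D2 φ t (slope m w y))
        + D2 (D2 φ) t (slope m w y) * transverse m w y i * transverse m w y l / √(quad m y)))
        + c * (2 * w k * ((∑ j, m l j * y j) / √(quad m y) * D1 φ t (slope m w y)
            + D2 (D1 φ) t (slope m w y) * transverse m w y l)
          + D2 (D2 φ) t (slope m w y) * transverse m w y l / √(quad m y) * ∑ j, m k j * y j
          + D2 φ t (slope m w y) * m k l)) y := by
  have hr : 0 < √(quad m y) := Real.sqrt_pos.2 hy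
  refine HasGrad.congr_grad ((hasGrad_sum Finset.univ fun i _ =>
    (hasGrad_linear fun j => Γ i k j).mul (hasGrad_abGrad hm hy hφ hφ2 i)).add
    ((((((hasGrad_quad hm).sqrt hy).const_mul 2).mul
      (hasGrad_comp_slope hm hy hφ1)).mul_const (w k)).add
      ((hasGrad_comp_slope hm hy hφ2).mul (hasGrad_linear (m k))) |>.const_mul c)) fun l => ?_
  congr 1
  field_simp
  ring

/-- The factor `P` in `G^i = (quadratic in y) + P y^i`. -/
noncomputable def sprayFactor (f g : ℝ → ℝ) (φ : ℝ → ℝ → ℝ) (m : Matrix (Fin n) (Fin n) ℝ)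
    (w : Fin n → ℝ) (t c : ℝ) (y : Fin n → ℝ) : ℝ :=
  √(quad m y) * ((c * (2 * D1 φ t (slope m w y) * slope m w y + D2 φ t (slope m w y))
    - c * (f t + g t * slope m w y ^ 2) * (slope m w y * φ t (slope m w y)
      + D2 φ t (slope m w y) * (t - slope m w y ^ 2))) / (2 * φ t (slope m w y)))

theorem sprayFactor_smul {c r : ℝ} (hr : 0 < r) (y : Coord n) :
    sprayFactor f g φ m w t c (r • y : Coord n) = r * sprayFactor f g φ m w t c y := by
  simp only [sprayFactor, slope_smul hr, sqrt_quad_smul hr, mul_assoc]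

theorem differentiableAt_sprayFactor {c : ℝ} (hm : m.IsSymm) (hy : 0 < quad m y)
    (h0 : φ t (slope m w y) ≠ 0)
    (hφ : DifferentiableAt ℝ (uncurry φ) (t, slope m w y))
    (hφ1 : DifferentiableAt ℝ (uncurry (D1 φ)) (t, slope m w y))
    (hφ2 : DifferentiableAt ℝ (uncurry (D2 φ)) (t, slope m w y)) :
    DifferentiableAt ℝ (fun y : Coord n => sprayFactor f g φ m w t c y) y := by
  have hα := ((hasGrad_quad hm).sqrt hy).1
  have hs := (hasGrad_slope (w := w) hm hy).1
  have d0 := (hasGrad_comp_slope hm hy hφ).1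
  have d1 := (hasGrad_comp_slope hm hy hφ1).1
  have d2 := (hasGrad_comp_slope hm hy hφ2).1
  unfold sprayFactor
  have hnum := (((d1.const_mul 2).mul hs).add d2).const_mul c |>.sub
    (((((hs.pow 2).const_mul (g t)).const_add (f t)).const_mul c).mul
      ((hs.mul d0).add (d2.mul ((hs.pow 2).const_sub t))))
  exact hα.mul (hnum.hasGrad.div (d0.const_mul 2).hasGrad (mul_ne_zero two_ne_zero h0)).1

/-- The quadratic part of the geodesic coefficients. -/
noncomputable def sprayQuadratic (f g : ℝ → ℝ) (Γ : Fin n → Fin n → Fin n → ℝ)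
    (m : Matrix (Fin n) (Fin n) ℝ) (w : Fin n → ℝ) (t c : ℝ) (i : Fin n) :
    Matrix (Fin n) (Fin n) ℝ :=
  Matrix.of fun j k => 1 / 2 * Γ i j k
    + 1 / 2 * c * (f t * m j k + g t * (w j * w k)) * sharp m w i

theorem quad_sprayQuadratic (Γ : Fin n → Fin n → Fin n → ℝ) (c : ℝ) (i : Fin n) (y : Fin n → ℝ) :
    quad (sprayQuadratic f g Γ m w t c i) y
      = 1 / 2 * ∑ j, (∑ k, Γ i j k * y k) * y j
        + 1 / 2 * c * (f t * quad m y + g t * formVal w y ^ 2) * sharp m w i := by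
  have h : formVal w y ^ 2 = ∑ j, (∑ k, w j * w k * y k) * y j := by
    rw [pow_two, formVal, Finset.sum_mul_sum]
    refine Finset.sum_congr rfl fun j _ => ?_
    rw [Finset.sum_mul]
    exact Finset.sum_congr rfl fun k _ => by ring
  rw [h]
  simp only [quad, sprayQuadratic, Matrix.of_apply, Finset.mul_sum, Finset.sum_mul,
    ← Finset.sum_add_distrib]
  exact Finset.sum_congr rfl fun j _ => Finset.sum_congr rfl fun k _ => by ring

theorem isOpen_transversal (m : Matrix (Fin n) (Fin n) ℝ) (w : Fin n → ℝ) (t : ℝ) :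
    IsOpen {y : Coord n | 0 < quad m y ∧ formVal w y ^ 2 < t * quad m y} := by
  have hq : Continuous fun y : Coord n => quad m y :=
    continuous_iff_continuousAt.2 fun y => (hasGrad_quad_of_matrix m y).1.continuousAt
  have hw : Continuous fun y : Coord n => formVal w y :=
    continuous_iff_continuousAt.2 fun y => (hasGrad_linear w).1.continuousAt
  exact (isOpen_lt continuous_const hq).inter (isOpen_lt (hw.pow 2) (continuous_const.mul hq))

/-- The right-hand side solves the linear system with matrix `4 g_{li}` that defines the geodesic
coefficients, and positive definiteness makes this solution unique. Strict Cauchy–Schwarz places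
`(b², s)` in the open domain, where `φ` is smooth and satisfies its equation. -/
theorem IsConformalChart.sprayCoeff_eq (h : IsConformalChart S a b c)
    (hφ : ContDiffOn ℝ ∞ (uncurry φ) (openDomain b₀))
    (hpde : ∀ p ∈ openDomain b₀, DouglasPDE f g φ p.1 p.2) {F : Coord n → Coord n → ℝ}
    (hF : ∀ x ∈ S, ∀ y, F x y
      = abNorm φ (a x) (fun i => b i x) (dualQuad (a x) fun i => b i x) y)
    (hx : x ∈ S) (hpos : (fundamentalTensor F x y).PosDef) (hy : 0 < quad (a x) y)
    (hs : formVal (fun i => b i x) y ^ 2 < dualQuad (a x) (fun i => b i x) * quad (a x) y)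
    (ht : ((√(dualQuad (a x) fun i => b i x) : ℝ) : EReal) < b₀)
    (h0 : φ (dualQuad (a x) fun i => b i x) (slope (a x) (fun i => b i x) y) ≠ 0) (i : Fin n) :
    sprayCoeff F i x y
      = quad (sprayQuadratic f g (fun i j k => christoffel a i j k x) (a x) (fun i => b i x)
          (dualQuad (a x) fun i => b i x) (c x) i) y
        + sprayFactor f g φ (a x) (fun i => b i x) (dualQuad (a x) fun i => b i x) (c x) y
          * y i := by
  have hm := h.isSymm hx
  set Γ : Fin n → Fin n → Fin n → ℝ := fun i j k => christoffel a i j k x with hΓ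
  set w : Fin n → ℝ := fun i => b i x with hw
  set t := dualQuad (a x) w with htdef
  have hΩ := isOpen_openDomain b₀
  -- The first derivatives are differentiated once more in `y`, so their formulas are needed on a
  -- whole neighbourhood of `y`.
  have hop := isOpen_transversal (a x) w t
  have hmem := hop.mem_nhds (show y ∈ _ from ⟨hy, hs⟩)
  have hdiff : ∀ {ψ : ℝ → ℝ → ℝ} {z : Coord n}, ContDiffOn ℝ ∞ (uncurry ψ) (openDomain b₀) →
      0 < quad (a x) z ∧ formVal w z ^ 2 < t * quad (a x) z →
      DifferentiableAt ℝ (uncurry ψ) (t, slope (a x) w z) := fun hψ hz =>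
    differentiableAt_of_smooth hΩ hψ (slope_mem_openDomain hz.1 hz.2 ht)
  have hφ1 := contDiffOn_D1 hΩ hφ
  have hφ2 := contDiffOn_D2 hΩ hφ
  set Fyy : Fin n → Fin n → ℝ := fun i l => (a x i l / √(quad (a x) y)
      - (∑ j, a x i j * y j) * (∑ j, a x l j * y j) / √(quad (a x) y) ^ 3)
      * (φ t (slope (a x) w y) - slope (a x) w y * D2 φ t (slope (a x) w y))
    + D2 (D2 φ) t (slope (a x) w y) * transverse (a x) w y i * transverse (a x) w y l
      / √(quad (a x) y) with hFyy
  have hGy := hasGrad_abNorm hm hy (hdiff hφ ⟨hy, hs⟩)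
  have hfund : ∀ i l, fundamentalTensor F x y l i
      = abGrad φ (a x) w t y l * abGrad φ (a x) w t y i
        + √(quad (a x) y) * φ t (slope (a x) w y) * Fyy i l := by
    intro i l
    have e : (fun y' => pd i (fun y'' => F x y'' ^ 2) y')
        =ᶠ[𝓝 y] fun y' => 2 * abNorm φ (a x) w t y' * abGrad φ (a x) w t y' i := by
      filter_upwards [hmem] with z hz
      have : (fun y'' => F x y'' ^ 2) = fun y'' : Coord n => abNorm φ (a x) w t y'' ^ 2 :=
        funext fun y' => by rw [hF x hx y']
      rw [this]
      exact (hasGrad_abNorm hm hz.1 (hdiff hφ hz)).sq.2 i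
    have hd := ((hGy.const_mul 2).mul (hasGrad_abGrad hm hy (hdiff hφ ⟨hy, hs⟩)
      (hdiff hφ2 ⟨hy, hs⟩) i)).congr_of_eventuallyEq e
    change (1 / 2 : ℝ) * _ = _
    rw [hd.2 l, abNorm, hFyy]
    ring
  set dFx : Fin n → Fin n → ℝ := fun k l => ∑ i, (Γ i k l * abGrad φ (a x) w t y i
      + (∑ j, Γ i k j * y j) * Fyy i l)
    + c x * (2 * w k * ((∑ j, a x l j * y j) / √(quad (a x) y) * D1 φ t (slope (a x) w y)
        + D2 (D1 φ) t (slope (a x) w y) * transverse (a x) w y l)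
      + D2 (D2 φ) t (slope (a x) w y) * transverse (a x) w y l / √(quad (a x) y)
        * ∑ j, a x k j * y j
      + D2 φ t (slope (a x) w y) * a x k l) with hdFx
  have hbase : ∀ z : Coord n, 0 < quad (a x) z ∧ formVal w z ^ 2 < t * quad (a x) z →
      ∀ k, pd k (fun x' => F x' z ^ 2) x
        = 2 * abNorm φ (a x) w t z * abGradBase φ Γ (a x) w t (c x) z k := by
    intro z hz k
    have e : (fun x' => F x' z ^ 2) =ᶠ[𝓝 x] fun x' =>
        abNorm φ (a x') (fun i => b i x') (dualQuad (a x') fun i => b i x') z ^ 2 := by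
      filter_upwards [h.isOpen.mem_nhds hx] with x' hx'
      rw [hF x' hx']
    exact ((h.hasGrad_abNorm_base hx hz.1 (hdiff hφ hz)).sq.congr_of_eventuallyEq e).2 k
  have hmixed : ∀ k l, pd l (fun y' => pd k (fun x' => F x' y' ^ 2) x) y
      = 2 * abGrad φ (a x) w t y l * abGradBase φ Γ (a x) w t (c x) y k
        + 2 * (√(quad (a x) y) * φ t (slope (a x) w y)) * dFx k l := by
    intro k l
    have e : (fun y' => pd k (fun x' => F x' y' ^ 2) x)
        =ᶠ[𝓝 y] fun y' => 2 * abNorm φ (a x) w t y' * abGradBase φ Γ (a x) w t (c x) y' k := by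
      filter_upwards [hmem] with z hz using hbase z hz k
    rw [(((hGy.const_mul 2).mul (hasGrad_abGradBase hm hy (hdiff hφ ⟨hy, hs⟩)
      (hdiff hφ1 ⟨hy, hs⟩) (hdiff hφ2 ⟨hy, hs⟩) k)).congr_of_eventuallyEq e).2 l, abNorm]
  have hr : 0 < √(quad (a x) y) := Real.sqrt_pos.2 hy
  have hrr : √(quad (a x) y) ^ 2 = quad (a x) y := Real.sq_sqrt hy.le
  have hsα : slope (a x) w y * √(quad (a x) y) = formVal w y := by
    rw [slope, div_mul_cancel₀ _ hr.ne']
  have hlow : ∀ l, ∑ i, a x i l * sharp (a x) w i = w l := fun l => by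
    rw [← sum_mul_sharp (h.det_ne_zero hx) w l]
    exact Finset.sum_congr rfl fun i _ => by rw [hm.apply]
  set G : Fin n → ℝ := fun i => quad (sprayQuadratic f g Γ (a x) w t (c x) i) y
        + sprayFactor f g φ (a x) w t (c x) y * y i with hG
  have key : ∀ l, (∑ k, pd l (fun y' => pd k (fun x' => F x' y' ^ 2) x) y * y k)
      - pd l (fun x' => F x' y ^ 2) x = 4 * ∑ i, fundamentalTensor F x y l i * G i := by
    intro l
    simp only [hmixed, hbase y ⟨hy, hs⟩, hfund, abNorm]
    refine spray_identity (a := a x) (Y := fun i => ∑ j, a x i j * y j) (b := w)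
      (bu := sharp (a x) w) (k := transverse (a x) w y) (Γ := Γ) (t := t)
      (N := fun i j => ∑ l, Γ i j l * y l) (s := slope (a x) w y) (c := c x)
      (φ1 := D1 φ t (slope (a x) w y)) (φ2 := D2 φ t (slope (a x) w y))
      (φ12 := D2 (D1 φ) t (slope (a x) w y)) (φ22 := D2 (D2 φ) t (slope (a x) w y))
      (κ := f t + g t * slope (a x) w y ^ 2) (P := sprayFactor f g φ (a x) w t (c x) y)
      hr.ne' ?_ ?_ ?_ ?_ ?_ hlow ?_ (fun _ _ => rfl) (fun _ => rfl) (fun _ => rfl)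
      (fun _ _ => rfl) (fun _ => rfl) (fun _ _ => rfl) ?_ ?_ ?_ l
    · rw [hrr, quad]
    · rw [hsα, formVal]
    · rfl
    · rw [hsα, formVal]
      simp only [Finset.sum_mul]
      rw [Finset.sum_comm]
      refine Finset.sum_congr rfl fun j _ => ?_
      rw [← hlow j, Finset.sum_mul]
      exact Finset.sum_congr rfl fun i _ => by ring
    · exact fun l => Finset.sum_congr rfl fun i _ => by rw [hm.apply]
    · exact fun i j l => h.christoffel_symm hx i j l
    · rw [sprayFactor]
      field_simp
    · intro i
      rw [hG]
      simp only
      rw [quad_sprayQuadratic, ← hsα, mul_pow, hrr]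
      ring
    · exact hpde _ (slope_mem_openDomain hy hs ht)
  have hinv : (fundamentalTensor F x y)⁻¹ * fundamentalTensor F x y = 1 :=
    Matrix.nonsing_inv_mul _ hpos.det_pos.ne'.isUnit
  change sprayCoeff F i x y = G i
  rw [sprayCoeff]
  simp only [key]
  have h1 : ∀ j, ∑ l, (fundamentalTensor F x y)⁻¹ i l * fundamentalTensor F x y l j
      = if i = j then 1 else 0 := fun j => by
    rw [← Matrix.mul_apply, hinv, Matrix.one_apply]
  calc (1 / 4 : ℝ) * ∑ l, (fundamentalTensor F x y)⁻¹ i l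
          * (4 * ∑ j, fundamentalTensor F x y l j * G j)
      = ∑ l, ∑ j, (fundamentalTensor F x y)⁻¹ i l * fundamentalTensor F x y l j * G j := by
        simp only [Finset.mul_sum]
        exact Finset.sum_congr rfl fun l _ => Finset.sum_congr rfl fun j _ => by ring
    _ = G i := by
        rw [Finset.sum_comm]
        simp only [← Finset.sum_mul, h1, ite_mul, one_mul, zero_mul, Finset.sum_ite_eq,
          Finset.mem_univ, if_true]

theorem IsConformalChart.douglasTensor_eq_zero_of_transversal (h : IsConformalChart S a b c)
    (hφ : ContDiffOn ℝ ∞ (uncurry φ) (openDomain b₀)) (hφ0 : ∀ p ∈ openDomain b₀, φ p.1 p.2 ≠ 0)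
    (hpde : ∀ p ∈ openDomain b₀, DouglasPDE f g φ p.1 p.2) {F : Coord n → Coord n → ℝ}
    (hF : ∀ x ∈ S, ∀ y, F x y
      = abNorm φ (a x) (fun i => b i x) (dualQuad (a x) fun i => b i x) y)
    (hx : x ∈ S) (hpos : ∀ y, y ≠ 0 → (fundamentalTensor F x y).PosDef) (hy : 0 < quad (a x) y)
    (hs : formVal (fun i => b i x) y ^ 2 < dualQuad (a x) (fun i => b i x) * quad (a x) y)
    (ht : ((√(dualQuad (a x) fun i => b i x) : ℝ) : EReal) < b₀) (i j k l : Fin n) :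
    douglasTensor F i j k l x y = 0 := by
  have hm := h.isSymm hx
  have hΩ := isOpen_openDomain b₀
  have hφ1 := contDiffOn_D1 hΩ hφ
  have hφ2 := contDiffOn_D2 hΩ hφ
  refine douglas_eq_zero_of_projective (G := fun i y => sprayCoeff F i x y)
    (isOpen_transversal (a x) (fun i => b i x)
    (dualQuad (a x) fun i => b i x))
    (sprayQuadratic f g (fun i j k => christoffel a i j k x) (a x) (fun i => b i x)
          (dualQuad (a x) fun i => b i x) (c x))
    (fun y => sprayFactor f g φ (a x) (fun i => b i x) (dualQuad (a x) fun i => b i x) (c x) y)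
    (fun z hz => ?_) (fun z hz => ?_) (fun z hz i => ?_) ⟨hy, hs⟩ i j k l
  · have hz' := slope_mem_openDomain hz.1 hz.2 ht
    exact differentiableAt_sprayFactor hm hz.1 (hφ0 _ hz') (differentiableAt_of_smooth hΩ hφ hz')
      (differentiableAt_of_smooth hΩ hφ1 hz') (differentiableAt_of_smooth hΩ hφ2 hz')
  · filter_upwards [eventually_gt_nhds one_pos] with r hr using sprayFactor_smul hr z
  · have hz0 : z ≠ 0 := by
      rintro rfl
      simp [quad] at hz
    exact h.sprayCoeff_eq hφ hpde hF hx (hpos z hz0) hz.1 hz.2 ht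
      (hφ0 _ (slope_mem_openDomain hz.1 hz.2 ht)) i

end Spray

/-! ### Charts: components of vectors, of the metric and of the form -/

section Chart

variable {n : ℕ} {M : Type*} [TopologicalSpace M] [ChartedSpace (Coord n) M]
  {e : OpenPartialHomeomorph M (Coord n)}

theorem mdifferentiable_of_mem_maximalAtlas (he : e ∈ IsManifold.maximalAtlas 𝓘(ℝ, Coord n) ∞ M) :
    e.MDifferentiable 𝓘(ℝ, Coord n) 𝓘(ℝ, Coord n) :=
  ⟨(contMDiffOn_of_mem_maximalAtlas he).mdifferentiableOn (by simp),
    (contMDiffOn_symm_of_mem_maximalAtlas he).mdifferentiableOn (by simp)⟩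

theorem chartVector_eq_sum (e : OpenPartialHomeomorph M (Coord n)) (x y : Coord n) :
    chartVector e x y = ∑ i, y i • chartVector e x (EuclideanSpace.single i 1) := by
  have hy : y = ∑ l, y l • EuclideanSpace.single l (1 : ℝ) := by
    ext i
    simp [Finset.sum_apply, Pi.single_apply]
  have h : chartVector e x (∑ l, y l • EuclideanSpace.single l (1 : ℝ))
      = ∑ i, y i • chartVector e x (EuclideanSpace.single i 1) := by
    unfold chartVector
    exact (map_sum (mfderiv 𝓘(ℝ, Coord n) 𝓘(ℝ, Coord n) e.symm x) _ _).trans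
      (Finset.sum_congr rfl fun i _ => map_smul _ _ _)
  rwa [← hy] at h

theorem chartVector_injective (he : e ∈ IsManifold.maximalAtlas 𝓘(ℝ, Coord n) ∞ M) {x : Coord n}
    (hx : x ∈ e.target) : Injective (chartVector e x) := by
  have h := (mdifferentiable_of_mem_maximalAtlas he).comp_symm_deriv hx
  intro u v huv
  have h1 := congrArg (mfderiv 𝓘(ℝ, Coord n) 𝓘(ℝ, Coord n) e (e.symm x)) huv
  have h2 := fun z => DFunLike.congr_fun h z
  exact (h2 u).symm.trans (h1.trans (h2 v))

theorem chartVector_surjective (he : e ∈ IsManifold.maximalAtlas 𝓘(ℝ, Coord n) ∞ M) {x : Coord n}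
    (hx : x ∈ e.target) : Surjective (chartVector e x) := by
  have h := (mdifferentiable_of_mem_maximalAtlas he).symm_comp_deriv (e.map_target hx)
  rw [e.right_inv hx] at h
  intro v
  exact ⟨mfderiv 𝓘(ℝ, Coord n) 𝓘(ℝ, Coord n) e (e.symm x) v, DFunLike.congr_fun h v⟩

theorem formVal_formInChart (β : ∀ x : M, TangentSpace 𝓘(ℝ, Coord n) x →L[ℝ] ℝ) (x y : Coord n) :
    formVal (fun i => formInChart β e i x) y = β (e.symm x) (chartVector e x y) := by
  rw [chartVector_eq_sum, map_sum]
  refine Finset.sum_congr rfl fun i _ => ?_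
  rw [map_smul, smul_eq_mul, mul_comm]
  rfl

variable [IsManifold 𝓘(ℝ, Coord n) ∞ M]

theorem quad_metricInChart (a : Metric n M) (x y : Coord n) :
    quad (metricInChart a e x) y
      = a.inner (e.symm x) (chartVector e x y) (chartVector e x y) := by
  rw [chartVector_eq_sum]
  simp only [map_sum, map_smul, sum_apply, smul_apply, smul_eq_mul]
  refine Finset.sum_congr rfl fun i _ => ?_
  rw [Finset.sum_mul, Finset.mul_sum]
  refine Finset.sum_congr rfl fun j _ => ?_
  rw [a.symm]
  simp only [metricInChart, Matrix.of_apply]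
  ring

/-- The map is the tangent map of `e.symm`, once the tangent bundle of the coordinate space is
identified with a product. -/
theorem smooth_chartVector (he : e ∈ IsManifold.maximalAtlas 𝓘(ℝ, Coord n) ∞ M) :
    ContMDiffOn 𝓘(ℝ, Coord n × Coord n) 𝓘(ℝ, Coord n).tangent ∞
      (fun p : Coord n × Coord n =>
        (⟨e.symm p.1, chartVector e p.1 p.2⟩ : TangentBundle 𝓘(ℝ, Coord n) M))
      (e.target ×ˢ univ) := by
  have h1 := (contMDiffOn_symm_of_mem_maximalAtlas he).contMDiffOn_tangentMapWithin (m := ∞)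
    le_rfl e.open_target.uniqueMDiffOn
  have h2 : ContMDiff 𝓘(ℝ, Coord n × Coord n) 𝓘(ℝ, Coord n).tangent ∞
      (fun p : Coord n × Coord n => (⟨p.1, p.2⟩ : TangentBundle 𝓘(ℝ, Coord n) (Coord n))) := by
    have h3 := contMDiff_tangentBundleModelSpaceHomeomorph_symm (I := 𝓘(ℝ, Coord n)) (n := ∞)
    -- The identity between the product as a normed space and as `ModelProd`; in charts it is again
    -- the identity.
    have h4 : ContMDiff (M' := ModelProd (Coord n) (Coord n)) 𝓘(ℝ, Coord n × Coord n)
        𝓘(ℝ, Coord n).tangent ∞ (fun p : Coord n × Coord n => p) :=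
      contMDiff_iff.2 ⟨continuous_id, fun _ _ => contDiffOn_id.congr fun _ _ => rfl⟩
    exact h3.comp h4
  refine (h1.comp h2.contMDiffOn (fun p hp => hp.1)).congr fun p hp => ?_
  simp only [comp_apply, tangentMapWithin, mfderivWithin_of_isOpen e.open_target hp.1]
  rfl

theorem contDiffOn_inChart {F : ∀ x : M, TangentSpace 𝓘(ℝ, Coord n) x → ℝ} (hF : IsFinsler F)
    (he : e ∈ IsManifold.maximalAtlas 𝓘(ℝ, Coord n) ∞ M) :
    ContDiffOn ℝ ∞ (fun p : Coord n × Coord n => inChart F e p.1 p.2) (e.target ×ˢ {0}ᶜ) := by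
  rw [← contMDiffOn_iff_contDiffOn]
  refine hF.smooth.comp ((smooth_chartVector he).mono (prod_mono_right (subset_univ _))) ?_
  rintro ⟨x, y⟩ ⟨hx, hy⟩ h0
  refine hy (chartVector_injective he hx ?_)
  refine Eq.trans h0 ?_
  unfold chartVector
  exact (map_zero (mfderiv 𝓘(ℝ, Coord n) 𝓘(ℝ, Coord n) e.symm x)).symm

theorem smooth_chartVector_const (he : e ∈ IsManifold.maximalAtlas 𝓘(ℝ, Coord n) ∞ M)
    (y : Coord n) : ContMDiffOn 𝓘(ℝ, Coord n) 𝓘(ℝ, Coord n).tangent ∞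
      (fun x : Coord n => (⟨e.symm x, chartVector e x y⟩ : TangentBundle 𝓘(ℝ, Coord n) M))
      e.target := by
  have h : ContMDiff 𝓘(ℝ, Coord n) 𝓘(ℝ, Coord n × Coord n) ∞ (fun x : Coord n => (x, y)) :=
    contMDiff_iff_contDiff.2 (contDiff_id.prodMk contDiff_const)
  exact (smooth_chartVector he).comp h.contMDiffOn fun x hx => ⟨hx, mem_univ _⟩

theorem contDiffOn_metricInChart (a : Metric n M)
    (he : e ∈ IsManifold.maximalAtlas 𝓘(ℝ, Coord n) ∞ M) (i j : Fin n) :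
    ContDiffOn ℝ ∞ (fun x => metricInChart a e x i j) e.target := by
  rw [← contMDiffOn_iff_contDiffOn]
  intro x hx
  have h : ContMDiffWithinAt 𝓘(ℝ, Coord n) (𝓘(ℝ, Coord n).prod 𝓘(ℝ)) ∞
      (fun x => TotalSpace.mk' ℝ (E := Bundle.Trivial M ℝ) (e.symm x)
        (a.inner (e.symm x) (chartVector e x (EuclideanSpace.single i 1))
          (chartVector e x (EuclideanSpace.single j 1)))) e.target x := by
    apply ContMDiffWithinAt.clm_bundle_apply₂ (F₁ := Coord n) (F₂ := Coord n)
    · exact ContMDiffAt.comp_contMDiffWithinAt x a.contMDiff.contMDiffAt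
        (contMDiffOn_symm_of_mem_maximalAtlas he x hx)
    · exact smooth_chartVector_const he _ x hx
    · exact smooth_chartVector_const he _ x hx
  simp only [contMDiffWithinAt_totalSpace] at h
  exact h.2

theorem contDiffOn_formInChart {β : ∀ x : M, TangentSpace 𝓘(ℝ, Coord n) x →L[ℝ] ℝ}
    (hβ : SmoothOneForm β) (he : e ∈ IsManifold.maximalAtlas 𝓘(ℝ, Coord n) ∞ M) (i : Fin n) :
    ContDiffOn ℝ ∞ (formInChart β e i) e.target := by
  rw [← contMDiffOn_iff_contDiffOn]
  intro x hx
  have h : ContMDiffWithinAt 𝓘(ℝ, Coord n) (𝓘(ℝ, Coord n).prod 𝓘(ℝ)) ∞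
      (fun x => TotalSpace.mk' ℝ (E := Bundle.Trivial M ℝ) (e.symm x)
        (β (e.symm x) (chartVector e x (EuclideanSpace.single i 1)))) e.target x := by
    apply ContMDiffWithinAt.clm_bundle_apply (F₁ := Coord n)
    · exact ContMDiffAt.comp_contMDiffWithinAt x hβ.contMDiffAt
        (contMDiffOn_symm_of_mem_maximalAtlas he x hx)
    · exact smooth_chartVector_const he _ x hx
  simp only [contMDiffWithinAt_totalSpace] at h
  exact h.2

theorem quad_eq_dotProduct (m : Matrix (Fin n) (Fin n) ℝ) (y : Fin n → ℝ) :
    quad m y = y ⬝ᵥ m.mulVec y := by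
  simp only [quad, dotProduct, Matrix.mulVec]
  exact Finset.sum_congr rfl fun i _ => mul_comm _ _

theorem _root_.Matrix.PosDef.quad_pos {m : Matrix (Fin n) (Fin n) ℝ} (hm : m.PosDef)
    {y : Fin n → ℝ} (hy : y ≠ 0) : 0 < quad m y := by
  rw [quad_eq_dotProduct]
  simpa using hm.dotProduct_mulVec_pos hy

theorem posDef_metricInChart (a : Metric n M)
    (he : e ∈ IsManifold.maximalAtlas 𝓘(ℝ, Coord n) ∞ M) {x : Coord n} (hx : x ∈ e.target) :
    (metricInChart a e x).PosDef := by
  refine Matrix.PosDef.of_dotProduct_mulVec_pos ?_ fun y hy => ?_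
  · ext i j
    simp only [metricInChart, Matrix.conjTranspose_apply, Matrix.of_apply, star_trivial]
    exact a.symm _ _ _
  · have h := quad_metricInChart (e := e) a x (WithLp.toLp 2 y)
    rw [star_trivial, ← quad_eq_dotProduct]
    refine h.symm ▸ a.pos _ _ fun h0 => hy ?_
    have h1 : WithLp.toLp 2 y = (0 : Coord n) := by
      refine chartVector_injective he hx (h0.trans ?_)
      unfold chartVector
      exact (map_zero (mfderiv 𝓘(ℝ, Coord n) 𝓘(ℝ, Coord n) e.symm x)).symm
    simpa using h1

theorem isConformalChart (a : Metric n M) {β : ∀ x : M, TangentSpace 𝓘(ℝ, Coord n) x →L[ℝ] ℝ}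
    {c : M → ℝ} (hβ : SmoothOneForm β) (hc : IsClosedConformal a β c)
    (he : e ∈ IsManifold.maximalAtlas 𝓘(ℝ, Coord n) ∞ M) :
    IsConformalChart e.target (metricInChart a e) (formInChart β e) (fun x => c (e.symm x)) where
  isOpen := e.open_target
  smooth_metric := contDiffOn_metricInChart a he
  smooth_form := contDiffOn_formInChart hβ he
  posDef _ hx := posDef_metricInChart a he hx
  covDeriv_eq := hc e he

/-! ### The dual norm and the Cauchy–Schwarz inequality -/

section CauchySchwarz

variable {m : Matrix (Fin n) (Fin n) ℝ} {w : Fin n → ℝ}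

theorem quad_sharp (hm : m.det ≠ 0) : quad m (sharp m w) = dualQuad m w := by
  simp only [quad, sum_mul_sharp hm, dualQuad, formVal]

theorem quad_add_smul (hm : m.PosDef) (r s : ℝ) (y : Fin n → ℝ) :
    quad m (r • y + s • sharp m w)
      = r ^ 2 * quad m y + 2 * r * s * formVal w y + s ^ 2 * dualQuad m w := by
  have hd := hm.det_pos.ne'
  have hsymm : m.IsSymm := (Matrix.isHermitian_iff_isSymm).1 hm.isHermitian
  have h1 : ∑ i, (∑ j, m i j * y j) * sharp m w i = formVal w y := by
    simp only [Finset.sum_mul]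
    rw [Finset.sum_comm, formVal]
    refine Finset.sum_congr rfl fun j _ => ?_
    rw [← sum_mul_sharp hd w j, Finset.sum_mul]
    exact Finset.sum_congr rfl fun i _ => by rw [hsymm.apply j i]; ring
  have h2 : ∀ i, ∑ j, m i j * (r • y + s • sharp m w) j
      = r * ∑ j, m i j * y j + s * w i := fun i => by
    rw [← sum_mul_sharp hd w i, Finset.mul_sum, Finset.mul_sum, ← Finset.sum_add_distrib]
    refine Finset.sum_congr rfl fun j _ => ?_
    simp only [Pi.add_apply, Pi.smul_apply, smul_eq_mul]
    ring
  have h3 : ∀ i, (∑ j, m i j * (r • y + s • sharp m w) j) * (r • y + s • sharp m w) i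
      = r ^ 2 * ((∑ j, m i j * y j) * y i) + r * s * ((∑ j, m i j * y j) * sharp m w i)
        + (r * s * (w i * y i) + s ^ 2 * (w i * sharp m w i)) := fun i => by
    rw [h2]
    simp only [Pi.add_apply, Pi.smul_apply, smul_eq_mul]
    ring
  rw [quad]
  simp only [h3, Finset.sum_add_distrib, ← Finset.mul_sum]
  rw [h1, ← quad, ← formVal, ← formVal, ← dualQuad]
  ring

theorem quad_nonneg (hm : m.PosDef) (y : Fin n → ℝ) : 0 ≤ quad m y := by
  by_cases hy : y = 0
  · simp [hy, quad]
  · exact (hm.quad_pos hy).le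

theorem dualQuad_nonneg (hm : m.PosDef) : 0 ≤ dualQuad m w := by
  rw [← quad_sharp hm.det_pos.ne']
  exact quad_nonneg hm _

theorem eq_zero_of_dualQuad_eq_zero (hm : m.PosDef) (h : dualQuad m w = 0) : w = 0 := by
  by_contra hw
  have hs : sharp m w ≠ 0 := fun h0 => hw (funext fun l => by
    rw [← sum_mul_sharp hm.det_pos.ne' w l, h0]
    simp)
  exact (hm.quad_pos hs).ne' ((quad_sharp hm.det_pos.ne').trans h)

theorem formVal_sq_le (hm : m.PosDef) (y : Fin n → ℝ) :
    formVal w y ^ 2 ≤ dualQuad m w * quad m y := by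
  rcases (dualQuad_nonneg (w := w) hm).eq_or_lt with h0 | hpos
  · rw [← h0, eq_zero_of_dualQuad_eq_zero hm h0.symm]
    simp [formVal]
  -- The form is evaluated at `b² y - β(y) b^♯`; its value is `b²` times the difference to be
  -- estimated.
  · have h := quad_nonneg hm (dualQuad m w • y + (-formVal w y) • sharp m w)
    rw [quad_add_smul hm] at h
    have : 0 ≤ dualQuad m w * (dualQuad m w * quad m y - formVal w y ^ 2) := by
      linarith
    linarith [nonneg_of_mul_nonneg_right this hpos]

end CauchySchwarz

/-- Cauchy–Schwarz bounds the supremum, and the normalised dual vector attains it. -/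
theorem betaNorm_eq (a : Metric n M) (β : ∀ x : M, TangentSpace 𝓘(ℝ, Coord n) x →L[ℝ] ℝ)
    (he : e ∈ IsManifold.maximalAtlas 𝓘(ℝ, Coord n) ∞ M) {x : Coord n} (hx : x ∈ e.target) :
    betaNorm a β (e.symm x)
      = √(dualQuad (metricInChart a e x) fun i => formInChart β e i x) := by
  have hm := posDef_metricInChart a he hx
  set m := metricInChart a e x
  set w : Fin n → ℝ := fun i => formInChart β e i x
  have hB := dualQuad_nonneg (w := w) hm
  refine IsGreatest.csSup_eq ⟨?_, ?_⟩
  -- If the form vanishes at the point, division by zero makes this the zero vector, which still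
  -- attains the value `0`.
  · let y : Coord n := WithLp.toLp 2 ((1 / √(dualQuad m w)) • sharp m w)
    have hq : quad m y = (1 / √(dualQuad m w)) ^ 2 * dualQuad m w := by
      have := quad_add_smul (w := w) hm 0 (1 / √(dualQuad m w)) 0
      simpa [y] using this
    have hf : formVal w y = √(dualQuad m w) := by
      have : formVal w y = 1 / √(dualQuad m w) * dualQuad m w := by
        simp only [formVal, dualQuad, y, Finset.mul_sum, Pi.smul_apply, smul_eq_mul]
        exact Finset.sum_congr rfl fun i _ => by ring
      rw [this, one_div, inv_mul_eq_div, Real.div_sqrt]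
    refine ⟨chartVector e x y, ?_, ?_⟩
    · rw [alpha, ← quad_metricInChart, Real.sqrt_le_iff, one_pow]
      refine ⟨zero_le_one, ?_⟩
      change quad m y ≤ 1
      rw [hq, div_pow, one_pow, Real.sq_sqrt hB, one_div, inv_mul_eq_div]
      exact div_self_le_one _
    · rw [← formVal_formInChart]
      change _ = |formVal w y|
      rw [hf, abs_of_nonneg (Real.sqrt_nonneg _)]
  · rintro _ ⟨v, hv, rfl⟩
    obtain ⟨y, rfl⟩ := chartVector_surjective he hx v
    rw [alpha, ← quad_metricInChart, Real.sqrt_le_iff, one_pow] at hv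
    rw [← formVal_formInChart]
    refine Real.abs_le_sqrt ((formVal_sq_le hm y).trans ?_)
    exact mul_le_of_le_one_right hB hv.2

theorem inChart_generalAB (a : Metric n M) (β : ∀ x : M, TangentSpace 𝓘(ℝ, Coord n) x →L[ℝ] ℝ)
    (φ : ℝ → ℝ → ℝ) (he : e ∈ IsManifold.maximalAtlas 𝓘(ℝ, Coord n) ∞ M) {x : Coord n}
    (hx : x ∈ e.target) (y : Coord n) : inChart (generalAB a β φ) e x y
      = abNorm φ (metricInChart a e x) (fun i => formInChart β e i x)
        (dualQuad (metricInChart a e x) fun i => formInChart β e i x) y := by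
  rw [inChart, generalAB, betaNorm_eq a β he hx,
    Real.sq_sqrt (dualQuad_nonneg (posDef_metricInChart a he hx)), alpha, ← quad_metricInChart,
    ← formVal_formInChart]
  rfl

end Chart

/-! ### Smoothness of the Douglas tensor -/

section Smoothness

variable {n : ℕ} {W : Set (Coord n × Coord n)} {u : Coord n → Coord n → ℝ}

theorem contDiffOn_pd_snd (hW : IsOpen W) (hu : ContDiffOn ℝ ∞ (fun p => u p.1 p.2) W)
    (l : Fin n) : ContDiffOn ℝ ∞ (fun p => pd l (fun y => u p.1 y) p.2) W := by
  refine ((hu.fderiv_of_isOpen hW le_rfl).clm_apply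
    (contDiffOn_const (c := (0, EuclideanSpace.single l 1)))).congr fun p hp => ?_
  have hd := ((hu.contDiffAt (hW.mem_nhds hp)).differentiableAt (by simp)).hasFDerivAt
  have hc : HasFDerivAt (fun y : Coord n => (p.1, y))
      (ContinuousLinearMap.inr ℝ (Coord n) (Coord n))
      p.2 := hasFDerivAt_prodMk_right p.1 p.2
  have h := HasFDerivAt.comp (f := fun y : Coord n => (p.1, y)) p.2 hd hc
  rw [pd]
  refine (congrArg (fun L : Coord n →L[ℝ] ℝ => L (EuclideanSpace.single l 1)) h.fderiv).trans ?_
  simp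

theorem contDiffOn_pd_fst (hW : IsOpen W) (hu : ContDiffOn ℝ ∞ (fun p => u p.1 p.2) W)
    (l : Fin n) : ContDiffOn ℝ ∞ (fun p => pd l (fun x => u x p.2) p.1) W := by
  refine ((hu.fderiv_of_isOpen hW le_rfl).clm_apply
    (contDiffOn_const (c := (EuclideanSpace.single l 1, 0)))).congr fun p hp => ?_
  have hd := ((hu.contDiffAt (hW.mem_nhds hp)).differentiableAt (by simp)).hasFDerivAt
  have hc : HasFDerivAt (fun x : Coord n => (x, p.2))
      (ContinuousLinearMap.inl ℝ (Coord n) (Coord n))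
      p.1 := hasFDerivAt_prodMk_left p.1 p.2
  have h := HasFDerivAt.comp (f := fun x : Coord n => (x, p.2)) p.1 hd hc
  rw [pd]
  refine (congrArg (fun L : Coord n →L[ℝ] ℝ => L (EuclideanSpace.single l 1)) h.fderiv).trans ?_
  simp

theorem contDiffOn_coord_snd (i : Fin n) :
    ContDiffOn ℝ ∞ (fun p : Coord n × Coord n => p.2 i) W :=
  ((EuclideanSpace.proj i : Coord n →L[ℝ] ℝ).contDiff.comp contDiff_snd).contDiffOn

variable {F : Coord n → Coord n → ℝ}

theorem contDiffOn_sprayCoeff (hW : IsOpen W) (hF : ContDiffOn ℝ ∞ (fun p => F p.1 p.2) W)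
    (hpos : ∀ p ∈ W, (fundamentalTensor F p.1 p.2).PosDef) (i : Fin n) :
    ContDiffOn ℝ ∞ (fun p => sprayCoeff F i p.1 p.2) W := by
  have h2 : ContDiffOn ℝ ∞ (fun p => F p.1 p.2 ^ 2) W := hF.pow 2
  have hx := fun k => contDiffOn_pd_fst (u := fun x y => F x y ^ 2) hW h2 k
  have hy := fun k => contDiffOn_pd_snd (u := fun x y => F x y ^ 2) hW h2 k
  have hT : ∀ i j, ContDiffOn ℝ ∞ (fun p => fundamentalTensor F p.1 p.2 i j) W := fun i j =>
    contDiffOn_const.mul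
      (contDiffOn_pd_snd (u := fun x y' => pd j (fun y'' => F x y'' ^ 2) y') hW (hy j) i)
  have hinv := contDiffOn_inv_apply hT fun p hp => (hpos p hp).det_pos.ne'
  unfold sprayCoeff
  refine contDiffOn_const.mul (ContDiffOn.sum fun l _ => (hinv i l).mul (ContDiffOn.sub
    (ContDiffOn.sum fun k _ => ContDiffOn.mul ?_ (contDiffOn_coord_snd k)) (hx l)))
  exact contDiffOn_pd_snd (u := fun x y' => pd k (fun x' => F x' y' ^ 2) x) hW (hx k) l

/-- Only continuity is used later: it carries the vanishing of the tensor from a dense set to all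
nonzero vectors. -/
theorem contDiffOn_douglasTensor (hW : IsOpen W) (hF : ContDiffOn ℝ ∞ (fun p => F p.1 p.2) W)
    (hpos : ∀ p ∈ W, (fundamentalTensor F p.1 p.2).PosDef) (i j k l : Fin n) :
    ContDiffOn ℝ ∞ (fun p => douglasTensor F i j k l p.1 p.2) W := by
  have hG := fun i => contDiffOn_sprayCoeff hW hF hpos i
  have h0 : ContDiffOn ℝ ∞ (fun p => sprayCoeff F i p.1 p.2 - (1 / ((n : ℝ) + 1))
      * (∑ m, pd m (fun y'' => sprayCoeff F m p.1 y'') p.2) * p.2 i) W :=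
    (hG i).sub ((contDiffOn_const.mul (ContDiffOn.sum fun m _ =>
      contDiffOn_pd_snd (u := fun x y => sprayCoeff F m x y) hW (hG m) m)).mul
        (contDiffOn_coord_snd i))
  have h1 := contDiffOn_pd_snd (u := fun x y => sprayCoeff F i x y - (1 / ((n : ℝ) + 1))
      * (∑ m, pd m (fun y'' => sprayCoeff F m x y'') y) * y i) hW h0 l
  have h2 := contDiffOn_pd_snd (u := fun x y' => pd l (fun y => sprayCoeff F i x y
      - (1 / ((n : ℝ) + 1)) * (∑ m, pd m (fun y'' => sprayCoeff F m x y'') y) * y i) y') hW h1 k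
  exact contDiffOn_pd_snd (u := fun x y' => pd k (pd l (fun y => sprayCoeff F i x y
      - (1 / ((n : ℝ) + 1)) * (∑ m, pd m (fun y'' => sprayCoeff F m x y'') y) * y i)) y') hW h2 j

end Smoothness

/-! ### Density of the transversal directions -/

section Density

variable {n : ℕ} {m : Matrix (Fin n) (Fin n) ℝ} {w : Fin n → ℝ}

theorem exists_formVal_eq_zero (hn : 2 ≤ n) (w : Fin n → ℝ) :
    ∃ v : Fin n → ℝ, v ≠ 0 ∧ formVal w v = 0 := by
  let L : (Fin n → ℝ) →ₗ[ℝ] ℝ := ∑ i, w i • LinearMap.proj i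
  have hL : ∀ v, L v = formVal w v := fun v => by simp [L, formVal]
  have hker : LinearMap.ker L ≠ ⊥ := LinearMap.ker_ne_bot_of_finrank_lt (by simp; omega)
  obtain ⟨v, hv, hv0⟩ := (Submodule.ne_bot_iff _).1 hker
  exact ⟨v, hv0, by rw [← hL]; exact hv⟩

theorem quad_add_add_quad_sub (y v : Fin n → ℝ) :
    quad m (y + v) + quad m (y - v) = 2 * quad m y + 2 * quad m v := by
  simp only [quad, Finset.sum_mul, Finset.mul_sum, ← Finset.sum_add_distrib, Pi.add_apply,
    Pi.sub_apply]
  exact Finset.sum_congr rfl fun i _ => Finset.sum_congr rfl fun j _ => by ring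

/-- Move `y` along a nonzero `v` in the kernel of the form, which exists as `n ≥ 2`. The value of
the form is unchanged, and by the parallelogram law at least one of `y ± r v` is strictly longer
than `y`, so Cauchy–Schwarz becomes strict there. -/
theorem mem_closure_transversal (hn : 2 ≤ n) (hm : m.PosDef) (hw : w ≠ 0) (y : Coord n) :
    y ∈ closure {y : Coord n | 0 < quad m y ∧ formVal w y ^ 2 < dualQuad m w * quad m y} := by
  have hB : 0 < dualQuad m w := (dualQuad_nonneg hm).lt_of_ne fun h =>
    hw (eq_zero_of_dualQuad_eq_zero hm h.symm)
  have hgood : ∀ z : Fin n → ℝ, formVal w z ^ 2 < dualQuad m w * quad m z →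
      0 < quad m z ∧ formVal w z ^ 2 < dualQuad m w * quad m z := fun z hz =>
    ⟨pos_of_mul_pos_right ((sq_nonneg _).trans_lt hz) hB.le, hz⟩
  obtain ⟨v, hv, hwv⟩ := exists_formVal_eq_zero hn w
  let v' : Coord n := WithLp.toLp 2 v
  have hqv : 0 < quad m v := hm.quad_pos hv
  have hform : ∀ r : ℝ, formVal w (y + r • v' : Coord n) = formVal w y := fun r => by
    have : formVal w (y + r • v' : Coord n) = formVal w y + r * formVal w v := by
      simp only [formVal, Finset.mul_sum, ← Finset.sum_add_distrib, PiLp.add_apply,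
        PiLp.smul_apply, smul_eq_mul, v']
      exact Finset.sum_congr rfl fun i _ => by ring
    rw [this, hwv, mul_zero, add_zero]
  rw [mem_closure_iff_nhds]
  intro N hN
  have hc : Continuous fun r : ℝ => y + r • v' := by fun_prop
  have h1 : ∀ᶠ r : ℝ in 𝓝 0, y + r • v' ∈ N := hc.tendsto' 0 y (by simp) hN
  have h2 : ∀ᶠ r : ℝ in 𝓝 0, y + (-r) • v' ∈ N :=
    (hc.comp continuous_neg).tendsto' 0 y (by simp) hN
  obtain ⟨r, ⟨hr1, hr2⟩, hr0⟩ :=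
    (((h1.and h2).filter_mono (nhdsWithin_le_nhds (s := {(0 : ℝ)}ᶜ))).and
      self_mem_nhdsWithin).exists
  have hpar : quad m (y + r • v' : Coord n) + quad m (y + (-r) • v' : Coord n)
      = 2 * quad m y + 2 * (r ^ 2 * quad m v) := by
    have h3 := quad_add_add_quad_sub (m := m) y (r • v' : Coord n)
    rw [quad_smul] at h3
    rw [neg_smul, ← sub_eq_add_neg]
    exact h3
  have hcs := formVal_sq_le (w := w) hm y
  have hr : 0 < r ^ 2 * quad m v := by
    have : r ≠ 0 := hr0
    positivity
  -- If the inequality fails at `y + r v`, the parallelogram law together with Cauchy–Schwarz at `y`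
  -- gives it at `y - r v`.
  by_cases hlt : formVal w y ^ 2 < dualQuad m w * quad m (y + r • v' : Coord n)
  · exact ⟨_, hr1, hgood _ (by rwa [hform])⟩
  · refine ⟨_, hr2, hgood _ ?_⟩
    rw [hform]
    have h4 : dualQuad m w * quad m (y + r • v' : Coord n)
        + dualQuad m w * quad m (y + (-r) • v' : Coord n)
        = 2 * (dualQuad m w * quad m y) + 2 * (dualQuad m w * (r ^ 2 * quad m v)) := by
      rw [← mul_add, hpar]
      ring
    have h5 := mul_pos hB hr
    push Not at hlt
    linarith

variable {S : Set (Coord n)} {a : Coord n → Matrix (Fin n) (Fin n) ℝ} {b : Fin n → Coord n → ℝ}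
  {c : Coord n → ℝ}

/-- If `β` vanished near `x`, so would its covariant derivative at `x`, whereas `c a_{ii} ≠ 0`. -/
theorem IsConformalChart.mem_closure_form_ne_zero (h : IsConformalChart S a b c) (hn : 0 < n)
    {x : Coord n} (hx : x ∈ S) (hc : c x ≠ 0) :
    x ∈ closure {x | x ∈ S ∧ (fun i => b i x) ≠ 0} := by
  by_contra hcl
  let i : Fin n := ⟨0, hn⟩
  have hev : ∀ᶠ z in 𝓝 x, ∀ j, b j z = 0 := by
    filter_upwards [h.isOpen.mem_nhds hx, isClosed_closure.isOpen_compl.mem_nhds hcl] with z hz hz'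
    by_contra hne
    exact hz' (subset_closure ⟨hz, fun h0 => hne fun j => congrFun h0 j⟩)
  have hpd : pd i (b i) x = 0 := by
    have e : b i =ᶠ[𝓝 x] fun _ => 0 := hev.mono fun z hz => hz i
    rw [pd, e.fderiv_eq]
    simp
  have h1 := h.covDeriv_eq x hx i i
  rw [covDeriv, hpd] at h1
  simp only [hev.self_of_nhds, mul_zero, Finset.sum_const_zero, sub_zero] at h1
  exact mul_ne_zero hc (h.posDef x hx).diag_pos.ne' h1.symm

variable {b₀ : EReal} {f g : ℝ → ℝ} {φ : ℝ → ℝ → ℝ} {F : Coord n → Coord n → ℝ}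

/-- Two passages to the limit: in the direction `y` at a fixed point with `β ≠ 0`, then in the base
point towards the zeros of `β`. -/
theorem IsConformalChart.douglasTensor_eq_zero (h : IsConformalChart S a b c) (hn : 2 ≤ n)
    (hc : ∀ x ∈ S, c x ≠ 0) (hφ : ContDiffOn ℝ ∞ (uncurry φ) (openDomain b₀))
    (hφ0 : ∀ p ∈ openDomain b₀, φ p.1 p.2 ≠ 0)
    (hpde : ∀ p ∈ openDomain b₀, DouglasPDE f g φ p.1 p.2)
    (hF : ∀ x ∈ S, ∀ y, F x y
      = abNorm φ (a x) (fun i => b i x) (dualQuad (a x) fun i => b i x) y)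
    (hsm : ContDiffOn ℝ ∞ (fun p : Coord n × Coord n => F p.1 p.2) (S ×ˢ {0}ᶜ))
    (hpos : ∀ x ∈ S, ∀ y, y ≠ 0 → (fundamentalTensor F x y).PosDef)
    (ht : ∀ x ∈ S, ((√(dualQuad (a x) fun i => b i x) : ℝ) : EReal) < b₀)
    {x y : Coord n} (hx : x ∈ S) (hy : y ≠ 0) (i j k l : Fin n) :
    douglasTensor F i j k l x y = 0 := by
  have hW : IsOpen (S ×ˢ ({0}ᶜ : Set (Coord n))) := h.isOpen.prod isOpen_compl_singleton
  have hD : ∀ x ∈ S, ∀ y, y ≠ 0 →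
      ContinuousAt (fun p : Coord n × Coord n => douglasTensor F i j k l p.1 p.2) (x, y) :=
    fun x hx y hy => (contDiffOn_douglasTensor hW hsm (fun p hp => hpos p.1 hp.1 p.2 hp.2)
      i j k l).continuousOn.continuousAt (hW.mem_nhds ⟨hx, hy⟩)
  have hfib : ∀ x ∈ S, (fun i => b i x) ≠ 0 → douglasTensor F i j k l x y = 0 := by
    intro x hx hb
    have hcont : ContinuousAt (fun y => douglasTensor F i j k l x y) y :=
      ContinuousAt.comp (f := fun y : Coord n => (x, y)) (hD x hx y hy)
        (Continuous.prodMk_right x).continuousAt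
    have := hcont.continuousWithinAt.mem_closure
      (mem_closure_transversal hn (h.posDef x hx) hb y)
      (show MapsTo _ _ ({0} : Set ℝ) from fun z hz =>
        h.douglasTensor_eq_zero_of_transversal hφ hφ0 hpde hF hx (hpos x hx) hz.1 hz.2
          (ht x hx) i j k l)
    simpa using this
  have hcont : ContinuousAt (fun x => douglasTensor F i j k l x y) x :=
    ContinuousAt.comp (f := fun x : Coord n => (x, y)) (hD x hx y hy)
      (Continuous.prodMk_left y).continuousAt
  have := hcont.continuousWithinAt.mem_closure
    (h.mem_closure_form_ne_zero (by omega) hx (hc x hx))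
    (show MapsTo _ _ ({0} : Set ℝ) from fun z hz => hfib z hz.1 hz.2)
  simpa using this

end Density

/-! ### The Douglas property on the manifold, and the main theorem -/

theorem isDouglas_generalAB {b₀ : EReal} {f g : ℝ → ℝ} {φ : ℝ → ℝ → ℝ}
    (hφ : ContDiffOn ℝ ∞ (uncurry φ) (openDomain b₀))
    (hφ0 : ∀ p ∈ openDomain b₀, φ p.1 p.2 ≠ 0)
    (hpde : ∀ p ∈ openDomain b₀, DouglasPDE f g φ p.1 p.2) {n : ℕ} (hn : 2 ≤ n)
    {M : Type*} [TopologicalSpace M] [ChartedSpace (Coord n) M] [IsManifold 𝓘(ℝ, Coord n) ∞ M]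
    (a : Metric n M) {β : ∀ x : M, TangentSpace 𝓘(ℝ, Coord n) x →L[ℝ] ℝ} {c : M → ℝ}
    (hβ : SmoothOneForm β) (hc : ∀ x, c x ≠ 0) (hconf : IsClosedConformal a β c)
    (hb : ∀ x, (betaNorm a β x : EReal) < b₀) (hF : IsFinsler (generalAB a β φ)) :
    IsDouglas (generalAB a β φ) := by
  refine ⟨hF, fun e he x hx y hy i j k l => ?_⟩
  exact (isConformalChart a hβ hconf he).douglasTensor_eq_zero hn (fun x _ => hc _) hφ hφ0 hpde
    (fun x hx y => inChart_generalAB a β φ he hx y) (contDiffOn_inChart hF he)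
    (hF.convex e he) (fun x hx => betaNorm_eq a β he hx ▸ hb _) hx hy i j k l

end GenAB

theorem theorem1p2 (b₀ : EReal) (hb₀ : 0 < b₀) (f g : ℝ → ℝ)
    (hf : ContDiffOn ℝ ∞ f (GenAB.baseInterval b₀))
    (hg : ContDiffOn ℝ ∞ g (GenAB.baseInterval b₀)) :
    -- every function given by the formula is a solution
    (∀ (P Q : ℝ → ℝ) (V : Set (ℝ × ℝ)),
      GenAB.IsAntiderivPair b₀ f g P Q → GenAB.IsRegion b₀ P Q V →
      ∀ (Φ h : ℝ → ℝ) (A φ : ℝ → ℝ → ℝ),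
        ContDiffOn ℝ ∞ Φ (GenAB.eta P Q '' V) → ContDiffOn ℝ ∞ h (Prod.fst '' V) →
        GenAB.IsIntegral P Q Φ A V → GenAB.SolutionFormula h A φ V →
        ContDiffOn ℝ ∞ (Function.uncurry φ) V ∧ ∀ p ∈ V, GenAB.DouglasPDE f g φ p.1 p.2) ∧
    -- every solution is given by the formula, with one `Φ` and one `h` wherever the level sets
    -- of `η` and the lines of constant `b²` are connected
    (∀ (P Q : ℝ → ℝ) (V : Set (ℝ × ℝ)),
      GenAB.IsAntiderivPair b₀ f g P Q → GenAB.IsRegion b₀ P Q V →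
      (∀ r : ℝ, IsPreconnected {p | p ∈ V ∧ GenAB.eta P Q p = r}) →
      (∀ t : ℝ, IsPreconnected {s : ℝ | (t, s) ∈ V}) →
      ∀ φ : ℝ → ℝ → ℝ, ContDiffOn ℝ ∞ (Function.uncurry φ) V →
        (∀ p ∈ V, GenAB.DouglasPDE f g φ p.1 p.2) →
        ∃ Φ : ℝ → ℝ, ContDiffOn ℝ ∞ Φ (GenAB.eta P Q '' V) ∧
          (∃ A : ℝ → ℝ → ℝ, GenAB.IsIntegral P Q Φ A V) ∧
          ∀ A : ℝ → ℝ → ℝ, GenAB.IsIntegral P Q Φ A V →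
            ∃ h : ℝ → ℝ, ContDiffOn ℝ ∞ h (Prod.fst '' V) ∧ GenAB.SolutionFormula h A φ V) ∧
    -- on an arbitrary open set the solutions are the functions locally given by the formula
    (∀ U : Set (ℝ × ℝ), IsOpen U → U ⊆ GenAB.openDomain b₀ →
      ∀ φ : ℝ → ℝ → ℝ, ContDiffOn ℝ ∞ (Function.uncurry φ) U →
        ((∀ p ∈ U, GenAB.DouglasPDE f g φ p.1 p.2) ↔
          GenAB.LocallyOfSolutionForm b₀ f g φ U)) ∧
    -- the corresponding general `(α, β)`-metrics are Douglas metrics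
    (∀ φ : ℝ → ℝ → ℝ,
      ContDiffOn ℝ ∞ (Function.uncurry φ) (GenAB.closedDomain b₀) →
      (∀ p ∈ GenAB.closedDomain b₀, 0 < φ p.1 p.2) →
      GenAB.LocallyOfSolutionForm b₀ f g φ (GenAB.openDomain b₀) →
      ∀ (n : ℕ), 2 ≤ n →
      ∀ (M : Type*) [TopologicalSpace M] [ChartedSpace (GenAB.Coord n) M]
        [IsManifold 𝓘(ℝ, GenAB.Coord n) ∞ M]
        (a : GenAB.Metric n M) (β : ∀ x : M, TangentSpace 𝓘(ℝ, GenAB.Coord n) x →L[ℝ] ℝ)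
        (c : M → ℝ),
        GenAB.SmoothOneForm β → (∀ x, c x ≠ 0) → GenAB.IsClosedConformal a β c →
        (∀ x, (GenAB.betaNorm a β x : EReal) < b₀) →
        GenAB.IsFinsler (GenAB.generalAB a β φ) →
        GenAB.IsDouglas (GenAB.generalAB a β φ)) := by
  refine ⟨fun P Q V hPQ hV Φ h A φ hΦ hh hA hform =>
      GenAB.solution_of_formula hf hg hPQ hV hΦ hh hA hform,
    fun P Q V hPQ hV hlev hsec φ hφ hpde =>
      GenAB.exists_formula_of_solution hf hg hPQ hV hlev hsec hφ hpde,
    fun U hU hUΩ φ hφ => GenAB.solution_iff_locallyOfSolutionForm hU hUΩ hf hg hφ,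
    fun φ hφ hpos hloc n hn M _ _ _ a β c hβ hc hconf hb hF => ?_⟩
  have hφ' := hφ.mono (GenAB.openDomain_subset_closedDomain b₀)
  -- The local formula is assumed only where `s ≠ 0`; the equivalence on open sets supplies the
  -- equation on the whole open domain, including `s = 0`.
  exact GenAB.isDouglas_generalAB hφ'
    (fun p hp => (hpos p (GenAB.openDomain_subset_closedDomain b₀ hp)).ne')
    ((GenAB.solution_iff_locallyOfSolutionForm (GenAB.isOpen_openDomain b₀) subset_rfl hf hg
      hφ').2 hloc) hn a hβ hc hconf hb hF
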